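/- Let $N\in\mathbb N$ and $\Delta t>0$. For $n\ge 0$ let $p^n(x)=(2\pi\Delta t)^{-n/2}e^{-|x|^2/(2\Delta t)}$ and let $\mu^n(dx)=p^n(x)\,dx$ be the Gaussian measure $N(0,\Delta t I)$ on $\mathbb R^n$. On $\mathbb R^N$ write $\Delta W_1,\dots,\Delta W_N$ for the coordinate maps and $\mathcal G_k=\sigma(\Delta W_1,\dots,\Delta W_k)$; functions of $(\Delta W_1,\dots,\Delta W_k)$ are identified with functions on $\mathbb R^k$. Let $$H_m(x)=\frac{(-1)^m}{\sqrt{m!}}\,e^{x^2/2}\frac{d^m}{dx^m}e^{-x^2/2}.$$ A generalized functional on $\mathbb R^n$ is a linear functional $\varphi\mapsto\langle X,\varphi\rangle$ on the test functions $\varphi\in (p^n)^{1/2}\mathcal S(\mathbb R^n)\subset\mathcal S(\mathbb R^n)$ such that $f\mapsto\langle X,(p^n)^{1/2}f\rangle$ is a tempered distribution, i.e. $X(p^n)^{1/2}\in\mathcal S'(\mathbb R^n)$. Tempered distributions (by restriction) and elements $X\in L^2(\mu^n)$ (by $\langle X,\varphi\rangle=\int X\varphi\,dx$) are generalized functionals.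 Derivatives are defined by $\langle\partial_kX,\varphi\rangle=-\langle X,\partial_k\varphi\rangle$. For a generalized functional $X$ on $\mathbb R^N$ and $0\le k\le N$, the conditional expectation $Y=\mathbf E[X\mid\mathcal G_k]$ is the generalized functional $Y$ on $\mathbb R^k$ with $$\langle X, Zp^N\rangle=\langle Y,Zp^k\rangle\qquad\text{for all }Z\in\mathcal S(\mathbb R^k),$$ where on the left $Z$ is regarded as the function $Z(x_1,\dots,x_k)$ on $\mathbb R^N$. **Theorem.** Let $X\in L^2(\mu^N)$ be real-valued. For all $m\ge1$ and $1\le l\le N$ the generalized conditional expectation $\mathbf E[\partial_l^mX\mid\mathcal G_{l-1}]$ exists, is unique, and is given by an element of $L^2(\mu^{l-1})$; the products $\mathbf E[\partial_l^mX\mid\mathcal G_{l-1}]\,H_m(\Delta W_l/\sqrt{\Delta t})$ belong to $L^2(\mu^N)$, and $$X-E[X]=\sum_{m=1}^\infty\sum_{l=1}^N\frac{(\Delta t)^{m/2}}{\sqrt{m!}}\,\mathbf E[\partial_l^mX\mid\mathcal G_{l-1}]\,H_m\!\left(\frac{\Delta W_l}{\sqrt{\Delta t}}\right),$$ where the series over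 $m$ converges in $L^2(\mu^N)$ (unconditionally). -/

import Mathlib

open MeasureTheory SchwartzMap LineDeriv

noncomputable section

namespace DiscreteWiener

/-- The density `p^n(x) = (2πΔt)^(-n/2) exp(-|x|²/(2Δt))` of `N(0, Δt I)` on `ℝⁿ`. -/
def density (n : ℕ) (Δt : ℝ) (x : Fin n → ℝ) : ℝ :=
  (2 * Real.pi * Δt) ^ (-(n : ℝ) / 2) * Real.exp (-(∑ i, x i ^ 2) / (2 * Δt))

/-- The Gaussian measure `μ^n(dx) = p^n(x) dx` on `ℝⁿ`. The coordinate maps are the increments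
`ΔW_1, …, ΔW_n` of the random walk, so `L²(𝒢_n)` is `L²(μ^n)`. -/
def gaussianMeasure (n : ℕ) (Δt : ℝ) : Measure (Fin n → ℝ) :=
  volume.withDensity fun x => ENNReal.ofReal (density n Δt x)

/-- The normalized Hermite function
`H_m(x) = (-1)^m / √(m!) * exp(x²/2) * (d/dx)^m exp(-x²/2)`. -/
def hermiteH (m : ℕ) (x : ℝ) : ℝ :=
  (-1) ^ m / Real.sqrt (m.factorial : ℝ) * Real.exp (x ^ 2 / 2) *
    iteratedDeriv m (fun y : ℝ => Real.exp (-y ^ 2 / 2)) x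

/-- The projection `ℝⁿ → ℝᵏ` onto the first `k` coordinates, `(ΔW_1, …, ΔW_k)`. -/
def firstCoords {k n : ℕ} (h : k ≤ n) (x : Fin n → ℝ) : Fin k → ℝ :=
  fun i => x (Fin.castLE h i)

/-! ### Gaussian functions are Schwartz functions -/

theorem exists_bound_pow_mul_exp {c : ℝ} (hc : 0 < c) (M : ℕ) :
    ∃ C : ℝ, ∀ t : ℝ, 0 ≤ t → (1 + t) ^ M * Real.exp (-(c * t ^ 2)) ≤ C := by
  refine ⟨2 ^ M * (M.factorial / c ^ M) * Real.exp c, fun t ht => ?_⟩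
  have h1 : (1 + t) ^ M ≤ 2 ^ M * (1 + t ^ 2) ^ M := by
    rw [← mul_pow]
    refine pow_le_pow_left₀ (by positivity) ?_ M
    nlinarith [sq_nonneg (t - 1), sq_nonneg t]
  have h2 : (1 + t ^ 2) ^ M ≤ M.factorial / c ^ M * Real.exp (c * (1 + t ^ 2)) := by
    have := Real.pow_div_factorial_le_exp (c * (1 + t ^ 2)) (by positivity) M
    rw [mul_pow, div_le_iff₀ (by positivity)] at this
    rw [div_mul_eq_mul_div, le_div_iff₀ (by positivity)]
    linarith
  calc (1 + t) ^ M * Real.exp (-(c * t ^ 2))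
      ≤ 2 ^ M * (M.factorial / c ^ M * Real.exp (c * (1 + t ^ 2))) *
          Real.exp (-(c * t ^ 2)) := by gcongr; exact h1.trans (by gcongr)
    _ = 2 ^ M * (M.factorial / c ^ M) *
          (Real.exp (c * (1 + t ^ 2)) * Real.exp (-(c * t ^ 2))) := by ring
    _ = _ := by rw [← Real.exp_add]; congr 2; ring

theorem hasTemperateGrowth_coord {n : ℕ} (i : Fin n) :
    (fun x : Fin n → ℝ => x i).HasTemperateGrowth :=
  (ContinuousLinearMap.proj (R := ℝ) (φ := fun _ : Fin n => ℝ) i).hasTemperateGrowth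

theorem hasTemperateGrowth_quad (n : ℕ) (c : ℝ) :
    (fun x : Fin n → ℝ => -(c * ∑ i, x i ^ 2)).HasTemperateGrowth := by
  have h1 : (fun x : Fin n → ℝ => ∑ i, x i ^ 2).HasTemperateGrowth :=
    Function.HasTemperateGrowth.sum fun i _ => (hasTemperateGrowth_coord i).pow 2
  exact ((Function.HasTemperateGrowth.const c).mul h1).neg

/-- `x ↦ exp(-c |x|²)` as a Schwartz function. -/
def gaussSchwartz (n : ℕ) (c : ℝ) (hc : 0 < c) : 𝓢(Fin n → ℝ, ℝ) where
  toFun := Real.exp ∘ fun x : Fin n → ℝ => -(c * ∑ i, x i ^ 2)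
  smooth' := Real.contDiff_exp.comp (hasTemperateGrowth_quad n c).1
  decay' k m := by
    have hq := hasTemperateGrowth_quad n c
    obtain ⟨j, C, hC, hb⟩ := hq.norm_iteratedFDeriv_le_uniform m
    obtain ⟨B, hB⟩ := exists_bound_pow_mul_exp hc (k + j * m)
    refine ⟨m.factorial * (C + 1) ^ m * B, fun x => ?_⟩
    have hx : ‖x‖ ^ 2 ≤ ∑ i, x i ^ 2 := by
      have h0 : 0 ≤ ∑ i, x i ^ 2 := Finset.sum_nonneg fun i _ => sq_nonneg _
      have : ‖x‖ ≤ Real.sqrt (∑ i, x i ^ 2) := by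
        refine (pi_norm_le_iff_of_nonneg (Real.sqrt_nonneg _)).2 fun i => ?_
        rw [Real.norm_eq_abs, ← Real.sqrt_sq_eq_abs]
        exact Real.sqrt_le_sqrt
          (Finset.single_le_sum (f := fun i => x i ^ 2) (fun i _ => sq_nonneg _)
            (Finset.mem_univ i))
      calc ‖x‖ ^ 2 ≤ Real.sqrt (∑ i, x i ^ 2) ^ 2 := by gcongr
        _ = _ := Real.sq_sqrt h0
    have hbase : 1 ≤ (C + 1) * (1 + ‖x‖) ^ j := by
      have : 1 ≤ (1 + ‖x‖) ^ j := one_le_pow₀ (by linarith [norm_nonneg x])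
      nlinarith
    have key := norm_iteratedFDeriv_comp_le (𝕜 := ℝ) (n := m) (N := (m : WithTop ℕ∞))
      Real.contDiff_exp (hq.1.of_le (by exact_mod_cast le_top)) le_rfl x
      (C := Real.exp (-(c * ∑ i, x i ^ 2))) (D := (C + 1) * (1 + ‖x‖) ^ j)
      (fun i _ => by
        rw [norm_iteratedFDeriv_eq_norm_iteratedDeriv, iteratedDeriv_eq_iterate,
          Real.iter_deriv_exp, Real.norm_eq_abs, abs_of_pos (Real.exp_pos _)])
      (fun i hi him => by
        refine (hb i him x).trans ?_
        refine le_trans ?_ (le_self_pow₀ hbase (by omega))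
        gcongr
        linarith)
    calc ‖x‖ ^ k * ‖iteratedFDeriv ℝ m _ x‖
        ≤ (1 + ‖x‖) ^ k * (m.factorial * Real.exp (-(c * ‖x‖ ^ 2)) *
            ((C + 1) * (1 + ‖x‖) ^ j) ^ m) := by
          refine mul_le_mul (pow_le_pow_left₀ (norm_nonneg x) (by linarith) k)
            (key.trans ?_) (norm_nonneg _) (by positivity)
          gcongr
      _ = m.factorial * (C + 1) ^ m *
            ((1 + ‖x‖) ^ (k + j * m) * Real.exp (-(c * ‖x‖ ^ 2))) := by
          rw [mul_pow, pow_add, pow_mul]; ring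
      _ ≤ _ := by gcongr; exact hB _ (norm_nonneg x)

theorem density_pos (n : ℕ) {Δt : ℝ} (h : 0 < Δt) (x : Fin n → ℝ) : 0 < density n Δt x := by
  unfold density; positivity

theorem continuous_density (n : ℕ) (Δt : ℝ) : Continuous (density n Δt) := by
  unfold density; fun_prop

/-- `√p^n` as a Schwartz function. -/
def sqrtDensity (n : ℕ) (Δt : ℝ) [h : Fact (0 < Δt)] : 𝓢(Fin n → ℝ, ℝ) :=
  Real.sqrt ((2 * Real.pi * Δt) ^ (-(n : ℝ) / 2)) •
    gaussSchwartz n (1 / (4 * Δt)) (by have := h.out; positivity)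

theorem sqrtDensity_eq (n : ℕ) (Δt : ℝ) [h : Fact (0 < Δt)] (x : Fin n → ℝ) :
    sqrtDensity n Δt x = Real.sqrt ((2 * Real.pi * Δt) ^ (-(n : ℝ) / 2)) *
      Real.exp (-(1 / (4 * Δt) * ∑ i, x i ^ 2)) := rfl

theorem sqrtDensity_apply (n : ℕ) (Δt : ℝ) [h : Fact (0 < Δt)] (x : Fin n → ℝ) :
    sqrtDensity n Δt x = Real.sqrt (density n Δt x) := by
  have h0 := h.out
  rw [sqrtDensity_eq, density, Real.sqrt_mul (by positivity), Real.sqrt_eq_rpow (Real.exp _),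
    ← Real.exp_mul]
  congr 2
  field_simp
  ring

theorem sqrtDensity_mul_self (n : ℕ) (Δt : ℝ) [h : Fact (0 < Δt)] (x : Fin n → ℝ) :
    sqrtDensity n Δt x * sqrtDensity n Δt x = density n Δt x := by
  rw [sqrtDensity_apply, Real.mul_self_sqrt (density_pos n h.out x).le]

/-! ### Generalized Wiener functionals -/

/-- The test functions: the Schwartz functions of the form `√p^n · f` with `f ∈ 𝒮(ℝⁿ)`.
(The sup norm of `Fin n → ℝ` and the Euclidean norm give the same Schwartz space.) -/
def testSpace (n : ℕ) (Δt : ℝ) : Submodule ℝ 𝓢(Fin n → ℝ, ℝ) where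
  carrier := {φ | ∃ f : 𝓢(Fin n → ℝ, ℝ), ∀ x, φ x = Real.sqrt (density n Δt x) * f x}
  zero_mem' := ⟨0, by simp⟩
  add_mem' := by
    rintro φ ψ ⟨f, hf⟩ ⟨g, hg⟩
    exact ⟨f + g, fun x => by simp [hf, hg, mul_add]⟩
  smul_mem' := by
    rintro c φ ⟨f, hf⟩
    exact ⟨c • f, fun x => by simp [hf, mul_left_comm]⟩

/-- A generalized Wiener functional `X` on `ℝⁿ`: a linear functional `φ ↦ ⟨X, φ⟩` on the test
functions, continuous in the sense that `f ↦ ⟨X, √p^n f⟩` is a tempered distribution, i.e.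
`X · √p^n ∈ 𝒮'(ℝⁿ)`. Every tempered distribution (`ofTempered`) and every element of `L²(μ^n)`
(`ofL2`) is one; elements of `L²(μ^n)` need not be tempered distributions themselves. -/
@[ext]
structure GenFunctional (n : ℕ) (Δt : ℝ) where
  /-- The coupling `φ ↦ ⟨X, φ⟩`. -/
  pair : testSpace n Δt →ₗ[ℝ] ℝ
  continuous_pair : ∃ U : 𝓢(Fin n → ℝ, ℝ) →L[ℝ] ℝ,
    ∀ (φ : testSpace n Δt) (f : 𝓢(Fin n → ℝ, ℝ)),
      (∀ x, φ.1 x = Real.sqrt (density n Δt x) * f x) → pair φ = U f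

/-- Multiplication by `√p^n` followed by `∂_k`, divided by `√p^n`:
`f ↦ ∂_k f - x_k/(2Δt) f`. -/
def conjDeriv {n : ℕ} (Δt : ℝ) (k : Fin n) : 𝓢(Fin n → ℝ, ℝ) →L[ℝ] 𝓢(Fin n → ℝ, ℝ) :=
  lineDerivOpCLM ℝ 𝓢(Fin n → ℝ, ℝ) (Pi.single k 1 : Fin n → ℝ) -
    (1 / (2 * Δt)) • smulLeftCLM ℝ (fun x : Fin n → ℝ => x k)

theorem lineDeriv_sqrt_mul {n : ℕ} {Δt : ℝ} [h : Fact (0 < Δt)] (k : Fin n)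
    {φ f : 𝓢(Fin n → ℝ, ℝ)} (hφ : ∀ x, φ x = Real.sqrt (density n Δt x) * f x)
    (x : Fin n → ℝ) :
    (∂_{(Pi.single k 1 : Fin n → ℝ)} φ) x =
      Real.sqrt (density n Δt x) * conjDeriv Δt k f x := by
  have h0 := h.out
  set K := Real.sqrt ((2 * Real.pi * Δt) ^ (-(n : ℝ) / 2)) with hK
  have hφ' : (φ : (Fin n → ℝ) → ℝ) = fun x =>
      (K * Real.exp (-(1 / (4 * Δt) * ∑ i, x i ^ 2))) * f x := by
    funext y; rw [hφ y, ← sqrtDensity_apply, sqrtDensity_eq]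
  have hsum : HasFDerivAt (fun y : Fin n → ℝ => ∑ i, y i ^ 2)
      (∑ i, (2 * x i) • ContinuousLinearMap.proj (R := ℝ) (φ := fun _ : Fin n => ℝ) i) x := by
    refine HasFDerivAt.fun_sum fun i _ => ?_
    have hp : HasFDerivAt (fun y : Fin n → ℝ => y i)
        (ContinuousLinearMap.proj (R := ℝ) (φ := fun _ : Fin n => ℝ) i) x :=
      (ContinuousLinearMap.proj (R := ℝ) (φ := fun _ : Fin n => ℝ) i).hasFDerivAt
    simpa using hp.pow 2
  have hd := (((hsum.const_mul (1 / (4 * Δt))).neg.exp).const_mul K).mul (f.hasFDerivAt x)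
  have hfd := hd.fderiv
  rw [lineDerivOp_apply_eq_fderiv, hφ']
  refine (congrArg (fun L => L (Pi.single k 1)) hfd).trans ?_
  rw [← sqrtDensity_apply, sqrtDensity_eq]
  have e : conjDeriv Δt k f x = fderiv ℝ f x (Pi.single k 1) - 1 / (2 * Δt) * (x k * f x) := by
    simp [conjDeriv, lineDerivOp_apply_eq_fderiv,
      smulLeftCLM_apply_apply (hasTemperateGrowth_coord k)]
  rw [e]
  have e2 : (∑ i, (2 * x i) • ContinuousLinearMap.proj (R := ℝ) (φ := fun _ : Fin n => ℝ) i)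
      (Pi.single k 1) = 2 * x k := by
    simp [Pi.single_apply]
  simp only [add_apply, smul_apply, neg_apply, e2, smul_eq_mul, Pi.neg_apply]
  rw [← hK]
  generalize Real.exp (-(1 / (4 * Δt) * ∑ i, x i ^ 2)) = E
  field_simp
  ring

/-- `∂_k` maps test functions to test functions. -/
def testDeriv {n : ℕ} {Δt : ℝ} [Fact (0 < Δt)] (k : Fin n) :
    testSpace n Δt →ₗ[ℝ] testSpace n Δt :=
  (lineDerivOpCLM ℝ 𝓢(Fin n → ℝ, ℝ) (Pi.single k 1 : Fin n → ℝ)).toLinearMap.restrict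
    (by
      rintro φ ⟨f, hf⟩
      exact ⟨conjDeriv Δt k f, fun x => lineDeriv_sqrt_mul k hf x⟩)

/-- The distributional partial derivative: `⟨∂_k X, φ⟩ = -⟨X, ∂_k φ⟩`. -/
def GenFunctional.deriv {n : ℕ} {Δt : ℝ} [Fact (0 < Δt)] (k : Fin n)
    (X : GenFunctional n Δt) : GenFunctional n Δt where
  pair := -(X.pair ∘ₗ testDeriv k)
  continuous_pair := by
    obtain ⟨U, hU⟩ := X.continuous_pair
    refine ⟨-(U ∘L conjDeriv Δt k), fun φ f hf => ?_⟩
    have := hU (testDeriv k φ) (conjDeriv Δt k f) fun x => lineDeriv_sqrt_mul k hf x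
    simp [this]

/-- The generalized functional given by a tempered distribution, by restriction. -/
def GenFunctional.ofTempered {n : ℕ} {Δt : ℝ} [Fact (0 < Δt)]
    (T : 𝓢(Fin n → ℝ, ℝ) →L[ℝ] ℝ) : GenFunctional n Δt where
  pair := T.toLinearMap ∘ₗ (testSpace n Δt).subtype
  continuous_pair := by
    refine ⟨T ∘L smulLeftCLM ℝ (sqrtDensity n Δt), fun φ f hf => ?_⟩
    have : φ.1 = smulLeftCLM ℝ (sqrtDensity n Δt) f := by
      ext x
      rw [smulLeftCLM_apply_apply (sqrtDensity n Δt).hasTemperateGrowth, hf, sqrtDensity_apply,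
        smul_eq_mul]
    simp [this]

theorem memLp_mul_sqrtDensity {n : ℕ} {Δt : ℝ} [h : Fact (0 < Δt)]
    (X : Lp ℝ 2 (gaussianMeasure n Δt)) :
    MemLp (fun x => X x * Real.sqrt (density n Δt x)) 2 volume := by
  have hm : Measurable fun x => ENNReal.ofReal (density n Δt x) :=
    (continuous_density n Δt).measurable.ennreal_ofReal
  have hac : (volume : Measure (Fin n → ℝ)) ≪ gaussianMeasure n Δt :=
    withDensity_absolutelyContinuous' hm.aemeasurable
      (Filter.Eventually.of_forall fun x => by simpa using density_pos n h.out x)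
  have hX := Lp.memLp X
  have hsm : AEStronglyMeasurable (fun x => X x * Real.sqrt (density n Δt x)) volume :=
    (hX.1.mono_ac hac).mul
      (Real.continuous_sqrt.comp (continuous_density n Δt)).aestronglyMeasurable
  rw [memLp_two_iff_integrable_sq hsm]
  have hi := (memLp_two_iff_integrable_sq hX.1).1 hX
  unfold gaussianMeasure at hi
  have hi := (integrable_withDensity_iff hm (by simp)).1 hi
  refine hi.congr (Filter.Eventually.of_forall fun x => ?_)
  have hp := (density_pos n h.out x).le
  simp only [mul_pow, Real.sq_sqrt hp, ENNReal.toReal_ofReal hp]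
  rfl

theorem integrable_mul_test {n : ℕ} {Δt : ℝ} [Fact (0 < Δt)]
    (X : Lp ℝ 2 (gaussianMeasure n Δt)) (φ : testSpace n Δt) :
    Integrable (fun x => X x * φ.1 x) := by
  obtain ⟨f, hf⟩ := φ.2
  refine ((memLp_mul_sqrtDensity X).integrable_mul (f.memLp 2)).congr
    (Filter.Eventually.of_forall fun x => ?_)
  simp [hf x, mul_assoc]

/-- The generalized functional `⟨X, φ⟩ = ∫ X(x) φ(x) dx` given by `X ∈ L²(μ^n)`. -/
def GenFunctional.ofL2 {n : ℕ} {Δt : ℝ} [Fact (0 < Δt)]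
    (X : Lp ℝ 2 (gaussianMeasure n Δt)) : GenFunctional n Δt where
  pair :=
    { toFun := fun φ => ∫ x, X x * φ.1 x
      map_add' := fun φ ψ => by
        rw [← integral_add (integrable_mul_test X φ) (integrable_mul_test X ψ)]
        simp [mul_add]
      map_smul' := fun c φ => by
        rw [RingHom.id_apply, smul_eq_mul, ← integral_const_mul]
        simp [mul_left_comm] }
  continuous_pair := by
    have hX := memLp_mul_sqrtDensity X
    refine ⟨innerSL ℝ hX.toLp ∘L toLpCLM ℝ ℝ 2 volume, fun φ f hf => ?_⟩
    change ∫ x, X x * φ.1 x = inner ℝ hX.toLp (f.toLp 2)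
    rw [L2.inner_def]
    refine integral_congr_ae ?_
    filter_upwards [hX.coeFn_toLp, f.coeFn_toLp 2] with x h1 h2
    rw [h1, h2, hf x]
    simp
    ring

/-- On tempered distributions, `deriv` is the usual distributional derivative. -/
theorem GenFunctional.deriv_ofTempered {n : ℕ} {Δt : ℝ} [Fact (0 < Δt)] (k : Fin n)
    (T : 𝓢(Fin n → ℝ, ℝ) →L[ℝ] ℝ) :
    (ofTempered T : GenFunctional n Δt).deriv k =
      ofTempered (-(T ∘L lineDerivOpCLM ℝ 𝓢(Fin n → ℝ, ℝ) (Pi.single k 1 : Fin n → ℝ))) := by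
  ext φ; rfl

/-- If `X ∈ L²(μ^n)` is a tempered distribution, then `ofL2 X` is that distribution. -/
theorem GenFunctional.ofL2_eq_ofTempered {n : ℕ} {Δt : ℝ} [Fact (0 < Δt)]
    (X : Lp ℝ 2 (gaussianMeasure n Δt)) (T : 𝓢(Fin n → ℝ, ℝ) →L[ℝ] ℝ)
    (hT : ∀ φ : 𝓢(Fin n → ℝ, ℝ), T φ = ∫ x, X x * φ x) : ofL2 X = ofTempered T := by
  ext φ; exact (hT φ.1).symm

/-- For `Z ∈ 𝒮(ℝᵏ)`, `k ≤ n`, the test function `Z p^n : x ↦ Z(x_1, …, x_k) p^n(x)` on `ℝⁿ`. -/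
def mulDensity {k n : ℕ} {Δt : ℝ} [Fact (0 < Δt)] (h : k ≤ n) (Z : 𝓢(Fin k → ℝ, ℝ)) :
    testSpace n Δt :=
  ⟨smulLeftCLM ℝ (fun x => Z (firstCoords h x))
      (smulLeftCLM ℝ (sqrtDensity n Δt) (sqrtDensity n Δt)),
    smulLeftCLM ℝ (fun x => Z (firstCoords h x)) (sqrtDensity n Δt), fun x => by
      have hZ : (fun x => Z (firstCoords h x)).HasTemperateGrowth :=
        Z.hasTemperateGrowth.comp (ContinuousLinearMap.pi fun i : Fin k =>
          ContinuousLinearMap.proj (R := ℝ) (φ := fun _ : Fin n => ℝ)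
            (Fin.castLE h i)).hasTemperateGrowth
      rw [smulLeftCLM_apply_apply hZ, smulLeftCLM_apply_apply hZ,
        smulLeftCLM_apply_apply (sqrtDensity n Δt).hasTemperateGrowth, ← sqrtDensity_apply]
      simp only [smul_eq_mul]
      ring⟩

theorem mulDensity_apply {k n : ℕ} {Δt : ℝ} [Fact (0 < Δt)] (h : k ≤ n)
    (Z : 𝓢(Fin k → ℝ, ℝ)) (x : Fin n → ℝ) :
    (mulDensity (Δt := Δt) h Z).1 x = Z (firstCoords h x) * density n Δt x := by
  have hZ : (fun x => Z (firstCoords h x)).HasTemperateGrowth :=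
    Z.hasTemperateGrowth.comp (ContinuousLinearMap.pi fun i : Fin k =>
      ContinuousLinearMap.proj (R := ℝ) (φ := fun _ : Fin n => ℝ)
        (Fin.castLE h i)).hasTemperateGrowth
  simp only [mulDensity]
  rw [smulLeftCLM_apply_apply hZ,
    smulLeftCLM_apply_apply (sqrtDensity n Δt).hasTemperateGrowth, smul_eq_mul, smul_eq_mul,
    sqrtDensity_mul_self]

/-- `Y = E[X | 𝒢_k]` in the generalized sense: `⟨X, Z p^n⟩ = ⟨Y, Z p^k⟩` for all `Z ∈ 𝒮(ℝᵏ)`. -/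
def IsCondExp {k n : ℕ} {Δt : ℝ} [Fact (0 < Δt)] (h : k ≤ n)
    (X : GenFunctional n Δt) (Y : GenFunctional k Δt) : Prop :=
  ∀ Z : 𝓢(Fin k → ℝ, ℝ), X.pair (mulDensity h Z) = Y.pair (mulDensity le_rfl Z)

/-- The `(m, l)` summand `Δt^(m/2)/√(m!) · Y(ΔW_1, …, ΔW_{l-1}) · H_m(ΔW_l/√Δt)`, a function on
`ℝᴺ`; the index `l : Fin N` starts at `0`, so `l` is the number of preceding coordinates. -/
def summand {N : ℕ} (Δt : ℝ) (m : ℕ) (l : Fin N) (Y : (Fin l → ℝ) → ℝ) (x : Fin N → ℝ) : ℝ :=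
  Δt ^ ((m : ℝ) / 2) / Real.sqrt (m.factorial : ℝ) * Y (firstCoords l.isLt.le x) *
    hermiteH m (x l / Real.sqrt Δt)

end DiscreteWiener

end

open DiscreteWiener

/-!
Write `x = (x₁, …, x_N)`. If `(H_m)` is an orthonormal basis of `L²` of the law of one increment
with `H₀ = 1`, the maps `Y ↦ Y(x₁, …, x_{l-1}) H_m(x_l)` for `m ≥ 1` and `1 ≤ l ≤ N` are isometries
into `L²(μ^N)` with pairwise orthogonal ranges, all orthogonal to the constants. A function that is
orthogonal to all of them and to the constants has vanishing integral over every box, by induction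
on the number of constrained coordinates, hence is zero. So `X - E[X]` is the sum of its orthogonal
projections onto these ranges, which are given by the adjoints of the isometries.

For the Hermite functions these adjoints are, up to normalization, the conditional expectations of
the derivatives: `∂_l^m (Z p^N)` is `(-1)^m` times a multiple of `Z H_m(x_l / √Δt) p^N` whenever `Z`
depends on `x₁, …, x_{l-1}` only. Uniqueness holds because every compactly supported smooth
function is of the form `Z √p`, and these functions are dense in the Schwartz space.
-/

noncomputable section

namespace DiscreteWiener

open Polynomial Filter Topology ProbabilityTheory
open scoped NNReal ENNReal InnerProduct

section Hilbert

variable {𝕜 E ι : Type*} {G : ι → Type*} [RCLike 𝕜] [NormedAddCommGroup E]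
  [InnerProductSpace 𝕜 E] [CompleteSpace E] [∀ i, NormedAddCommGroup (G i)]
  [∀ i, InnerProductSpace 𝕜 (G i)] [∀ i, CompleteSpace (G i)] {V : ∀ i, G i →ₗᵢ[𝕜] E}

theorem adjoint_linearIsometry_apply (hV : OrthogonalFamily 𝕜 G V) (x : E) (i : ι) :
    (hV.linearIsometry.toContinuousLinearMap.adjoint x : lp G 2) i =
      (V i).toContinuousLinearMap.adjoint x := by
  classical
  refine ext_inner_left 𝕜 fun v => ?_
  rw [← lp.inner_single_left, ContinuousLinearMap.adjoint_inner_right,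
    ContinuousLinearMap.adjoint_inner_right]
  simp [hV.linearIsometry_apply_single]

theorem hasSum_adjoint_of_forall_inner_eq_zero (hV : OrthogonalFamily 𝕜 G V) {e : E}
    (he : ‖e‖ = 1) (heV : ∀ i v, inner 𝕜 e (V i v) = 0)
    (htot : ∀ y, inner 𝕜 e y = 0 → (∀ i v, inner 𝕜 (V i v) y = 0) → y = 0) (x : E) :
    HasSum (fun i => V i ((V i).toContinuousLinearMap.adjoint x)) (x - (inner 𝕜 e x : 𝕜) • e) := by
  have hsum := hV.hasSum_linearIsometry (hV.linearIsometry.toContinuousLinearMap.adjoint x)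
  simp only [adjoint_linearIsometry_apply hV] at hsum
  set s := hV.linearIsometry (hV.linearIsometry.toContinuousLinearMap.adjoint x)
  have hes : inner 𝕜 e s = 0 :=
    (hsum.mapL (innerSL 𝕜 e)).unique (by simp [heV])
  have hVs (i : ι) (v : G i) : inner 𝕜 (V i v) s = inner 𝕜 (V i v) x := by
    classical
    rw [← hV.linearIsometry_apply_single, LinearIsometry.inner_map_map]
    exact ContinuousLinearMap.adjoint_inner_right _ _ _
  suffices x - (inner 𝕜 e x : 𝕜) • e - s = 0 by rwa [sub_eq_zero.1 this]
  refine htot _ ?_ fun i v => ?_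
  · simp [inner_sub_right, inner_smul_right, hes, inner_self_eq_norm_sq_to_K, he]
  · have : inner 𝕜 (V i v) e = 0 := inner_eq_zero_symm.1 (heV i v)
    simp [inner_sub_right, inner_smul_right, hVs, this]

end Hilbert

section Tensor

variable {𝕜 Ω Ω' : Type*} [RCLike 𝕜] [MeasurableSpace Ω] [MeasurableSpace Ω'] {μ : Measure Ω}
  {ν : Measure Ω'}

theorem memLp_two_mul_prod {f : Ω → 𝕜} {g : Ω' → 𝕜} (hf : MemLp f 2 μ) (hg : MemLp g 2 ν) :
    MemLp (fun z : Ω × Ω' => f z.1 * g z.2) 2 (μ.prod ν) := by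
  refine (memLp_two_iff_integrable_sq_norm (hf.1.comp_fst.mul hg.1.comp_snd)).2 ?_
  simp only [Pi.mul_apply, norm_mul, mul_pow]
  exact ((memLp_two_iff_integrable_sq_norm hf.1).1 hf).mul_prod
    ((memLp_two_iff_integrable_sq_norm hg.1).1 hg)

/-- The tensor product `(f ⊗ g)(x, y) = f x * g y` of two square integrable functions. -/
def tensor (f : Lp 𝕜 2 μ) (g : Lp 𝕜 2 ν) : Lp 𝕜 2 (μ.prod ν) :=
  (memLp_two_mul_prod (Lp.memLp f) (Lp.memLp g)).toLp

theorem coeFn_tensor (f : Lp 𝕜 2 μ) (g : Lp 𝕜 2 ν) :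
    tensor f g =ᵐ[μ.prod ν] fun z => f z.1 * g z.2 :=
  MemLp.coeFn_toLp _

theorem tensor_indicatorConstLp_one [IsFiniteMeasure μ] [IsFiniteMeasure ν] {A : Set Ω}
    {B : Set Ω'} (hA : MeasurableSet A) (hB : MeasurableSet B) :
    tensor (indicatorConstLp 2 hA (measure_ne_top μ A) (1 : 𝕜))
        (indicatorConstLp 2 hB (measure_ne_top ν B) (1 : 𝕜)) =
      indicatorConstLp 2 (hA.prod hB) (measure_ne_top (μ.prod ν) _) (1 : 𝕜) := by
  have hA' := indicatorConstLp_coeFn (p := 2) (hs := hA) (hμs := measure_ne_top μ A) (c := (1 : 𝕜))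
  have hB' := indicatorConstLp_coeFn (p := 2) (hs := hB) (hμs := measure_ne_top ν B) (c := (1 : 𝕜))
  refine Lp.ext ((coeFn_tensor _ _).trans (EventuallyEq.trans ?_ indicatorConstLp_coeFn.symm))
  filter_upwards [Measure.quasiMeasurePreserving_fst.ae hA',
    Measure.quasiMeasurePreserving_snd.ae hB'] with z h₁ h₂
  rw [h₁, h₂]
  exact Set.indicator_prod_one.symm

variable [SFinite μ] [SFinite ν]

theorem inner_tensor_tensor (f f' : Lp 𝕜 2 μ) (g g' : Lp 𝕜 2 ν) :
    inner 𝕜 (tensor f g) (tensor f' g') = inner 𝕜 f f' * inner 𝕜 g g' := by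
  simp only [L2.inner_def]
  rw [← integral_prod_mul]
  refine integral_congr_ae ?_
  filter_upwards [coeFn_tensor f g, coeFn_tensor f' g'] with z h h'
  simp only [h, h', RCLike.inner_apply, map_mul]
  ring

theorem norm_tensor (f : Lp 𝕜 2 μ) (g : Lp 𝕜 2 ν) : ‖tensor f g‖ = ‖f‖ * ‖g‖ := by
  have h := inner_tensor_tensor f f g g
  simp only [inner_self_eq_norm_sq_to_K, ← mul_pow] at h
  norm_cast at h
  exact (pow_left_inj₀ (norm_nonneg _) (by positivity) two_ne_zero).1 h

/-- `tensor` as a continuous bilinear map. -/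
def tensorL (𝕜 : Type*) [RCLike 𝕜] (μ : Measure Ω) (ν : Measure Ω') [SFinite μ] [SFinite ν] :
    Lp 𝕜 2 μ →L[𝕜] Lp 𝕜 2 ν →L[𝕜] Lp 𝕜 2 (μ.prod ν) :=
  LinearMap.mkContinuous₂
    (LinearMap.mk₂ 𝕜 tensor
      (fun f f' g => by
        refine Lp.ext ?_
        filter_upwards [coeFn_tensor (f + f') g, coeFn_tensor f g, coeFn_tensor f' g,
          Lp.coeFn_add (tensor f g) (tensor f' g),
          Measure.quasiMeasurePreserving_fst.ae (Lp.coeFn_add f f')] with z h₁ h₂ h₃ h₄ h₅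
        simp only [h₁, h₂, h₃, h₄, h₅, Pi.add_apply, add_mul])
      (fun c f g => by
        refine Lp.ext ?_
        filter_upwards [coeFn_tensor (c • f) g, coeFn_tensor f g, Lp.coeFn_smul c (tensor f g),
          Measure.quasiMeasurePreserving_fst.ae (Lp.coeFn_smul c f)] with z h₁ h₂ h₃ h₄
        simp only [h₁, h₂, h₃, h₄, Pi.smul_apply, smul_mul_assoc])
      (fun f g g' => by
        refine Lp.ext ?_
        filter_upwards [coeFn_tensor f (g + g'), coeFn_tensor f g, coeFn_tensor f g',
          Lp.coeFn_add (tensor f g) (tensor f g'),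
          Measure.quasiMeasurePreserving_snd.ae (Lp.coeFn_add g g')] with z h₁ h₂ h₃ h₄ h₅
        simp only [h₁, h₂, h₃, h₄, h₅, Pi.add_apply, mul_add])
      (fun c f g => by
        refine Lp.ext ?_
        filter_upwards [coeFn_tensor f (c • g), coeFn_tensor f g, Lp.coeFn_smul c (tensor f g),
          Measure.quasiMeasurePreserving_snd.ae (Lp.coeFn_smul c g)] with z h₁ h₂ h₃ h₄
        simp only [h₁, h₂, h₃, h₄, Pi.smul_apply, mul_smul_comm]))
    1 fun f g => by simp [norm_tensor]

end Tensor

section PiSystem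

theorem setIntegral_eq_zero_of_isPiSystem {Ω E : Type*} [m : MeasurableSpace Ω]
    [NormedAddCommGroup E] [NormedSpace ℝ E] {μ : Measure Ω} {f : Ω → E} (hf : Integrable f μ)
    {S : Set (Set Ω)} (hgen : m = MeasurableSpace.generateFrom S) (hpi : IsPiSystem S)
    (huniv : ∫ x, f x ∂μ = 0) (hS : ∀ t ∈ S, ∫ x in t, f x ∂μ = 0) {t : Set Ω}
    (ht : MeasurableSet t) : ∫ x in t, f x ∂μ = 0 := by
  induction t, ht using MeasurableSpace.induction_on_inter hgen hpi with
  | empty => simp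
  | basic t ht => exact hS t ht
  | compl t htm ih => rw [setIntegral_compl htm hf, huniv, ih, sub_zero]
  | iUnion s hdisj hsm ih =>
    rw [integral_iUnion hsm hdisj hf.integrableOn]
    simp only [ih, tsum_zero]

theorem ae_eq_zero_of_setIntegral_pi_eq_zero {ι E : Type*} [Finite ι] {α : ι → Type*}
    [∀ i, MeasurableSpace (α i)] [NormedAddCommGroup E] [NormedSpace ℝ E] [CompleteSpace E]
    {μ : Measure (∀ i, α i)} {f : (∀ i, α i) → E} (hf : Integrable f μ)
    (h : ∀ s : ∀ i, Set (α i), (∀ i, MeasurableSet (s i)) → ∫ x in Set.univ.pi s, f x ∂μ = 0) :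
    f =ᵐ[μ] 0 := by
  refine hf.ae_eq_zero_of_forall_setIntegral_eq_zero fun t ht _ =>
    setIntegral_eq_zero_of_isPiSystem hf generateFrom_pi.symm isPiSystem_pi ?_ ?_ ht
  · simpa using h (fun _ => Set.univ) fun _ => MeasurableSet.univ
  · rintro _ ⟨s, hs, rfl⟩
    exact h s fun i => hs i (Set.mem_univ i)

end PiSystem

section Past

variable {𝕜 α : Type*} [RCLike 𝕜] [MeasurableSpace α] {ν : Measure α}

/-- A sequence `x` cut at time `l`: the values before time `l` and the value at time `l`. -/
def splitAt {n : ℕ} (l : Fin n) (x : Fin n → α) : (Fin l → α) × α :=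
  (Fin.take l l.isLt.le x, x l)

theorem measurePreserving_take [IsProbabilityMeasure ν] {k n : ℕ} (h : k ≤ n) :
    MeasurePreserving (fun x : Fin n → α => Fin.take k h x) (Measure.pi fun _ => ν)
      (Measure.pi fun _ => ν) := by
  have hind : iIndepFun (fun (i : Fin n) (x : Fin n → α) => x i) (Measure.pi fun _ => ν) :=
    iIndepFun_pi fun _ => aemeasurable_id
  refine ⟨measurable_pi_lambda _ fun i => measurable_pi_apply _, ?_⟩
  refine ((hind.precomp (Fin.castLE_injective h)).map_fun_eq_pi_map
    fun i => (measurable_pi_apply _).aemeasurable).trans ?_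
  simp_rw [(measurePreserving_eval (fun _ : Fin n => ν) _).map_eq]

theorem measurePreserving_splitAt [IsProbabilityMeasure ν] {n : ℕ} (l : Fin n) :
    MeasurePreserving (splitAt l) (Measure.pi fun _ : Fin n => ν)
      ((Measure.pi fun _ : Fin l => ν).prod ν) := by
  have hlast := Measure.measurePreserving_swap.comp
    (measurePreserving_piFinSuccAbove (fun _ : Fin (l + 1) => ν) (Fin.last l))
  convert! hlast.comp (measurePreserving_take (ν := ν) (Nat.succ_le_of_lt l.isLt)) using 1
  funext x
  refine Prod.ext (funext fun i => ?_) rfl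
  simp [splitAt, MeasurableEquiv.piFinSuccAbove, Fin.take]
  rfl

variable [SFinite ν] {P : ∀ n, Measure (Fin n → α)} [∀ n, SFinite (P n)]
  (hP : ∀ n (l : Fin n), MeasurePreserving (splitAt l) (P n) ((P l).prod ν))

/-- The product `Y(x₁, …, x_{l-1}) g(x_l)` of a function of the values before time `l` with a
function of the value at time `l`, as a continuous bilinear map. -/
def pastMul (𝕜 : Type*) [RCLike 𝕜]
    (hP : ∀ n (l : Fin n), MeasurePreserving (splitAt l) (P n) ((P l).prod ν)) {n : ℕ}
    (l : Fin n) : Lp 𝕜 2 (P l) →L[𝕜] Lp 𝕜 2 ν →L[𝕜] Lp 𝕜 2 (P n) :=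
  ContinuousLinearMap.compL 𝕜 _ _ _
    (Lp.compMeasurePreservingₗᵢ 𝕜 (splitAt l) (hP n l)).toContinuousLinearMap ∘L tensorL 𝕜 (P l) ν

theorem pastMul_apply {n : ℕ} (l : Fin n) (Y : Lp 𝕜 2 (P l)) (g : Lp 𝕜 2 ν) :
    pastMul 𝕜 hP l Y g = Lp.compMeasurePreservingₗᵢ 𝕜 (splitAt l) (hP n l) (tensor Y g) :=
  rfl

theorem coeFn_pastMul {n : ℕ} (l : Fin n) (Y : Lp 𝕜 2 (P l)) (g : Lp 𝕜 2 ν) :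
    pastMul 𝕜 hP l Y g =ᵐ[P n] fun x => Y (Fin.take l l.isLt.le x) * g (x l) :=
  (Lp.coeFn_compMeasurePreserving _ (hP n l)).trans
    ((hP n l).quasiMeasurePreserving.ae_eq_comp (coeFn_tensor Y g))

theorem inner_pastMul_pastMul {n : ℕ} (l : Fin n) (Y Y' : Lp 𝕜 2 (P l)) (g g' : Lp 𝕜 2 ν) :
    inner 𝕜 (pastMul 𝕜 hP l Y g) (pastMul 𝕜 hP l Y' g') = inner 𝕜 Y Y' * inner 𝕜 g g' := by
  rw [pastMul_apply, pastMul_apply, LinearIsometry.inner_map_map, inner_tensor_tensor]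

theorem norm_pastMul {n : ℕ} (l : Fin n) (Y : Lp 𝕜 2 (P l)) (g : Lp 𝕜 2 ν) :
    ‖pastMul 𝕜 hP l Y g‖ = ‖Y‖ * ‖g‖ := by
  rw [pastMul_apply, LinearIsometry.norm_map, norm_tensor]

/-- `Y ↦ Y(x₁, …, x_{l-1}) g(x_l)` as an isometry, for a unit vector `g`. -/
def pastMulₗᵢ {n : ℕ} (l : Fin n) {g : Lp 𝕜 2 ν} (hg : ‖g‖ = 1) :
    Lp 𝕜 2 (P l) →ₗᵢ[𝕜] Lp 𝕜 2 (P n) where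
  toLinearMap := ((pastMul 𝕜 hP l).flip g).toLinearMap
  norm_map' Y := by simp [norm_pastMul, hg]

theorem pastMulₗᵢ_apply {n : ℕ} (l : Fin n) {g : Lp 𝕜 2 ν} (hg : ‖g‖ = 1) (Y : Lp 𝕜 2 (P l)) :
    pastMulₗᵢ hP l hg Y = pastMul 𝕜 hP l Y g :=
  rfl

end Past

section Chaos

variable {𝕜 α ι : Type*} [RCLike 𝕜] [MeasurableSpace α] {ν : Measure α} [IsProbabilityMeasure ν]
  {P : ∀ n, Measure (Fin n → α)} [∀ n, IsProbabilityMeasure (P n)]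
  (hP : ∀ n (l : Fin n), MeasurePreserving (splitAt l) (P n) ((P l).prod ν))

theorem pastMul_indicatorConstLp_one {n : ℕ} (l : Fin n) {A : Set (Fin l → α)}
    (hA : MeasurableSet A) {B : Set α} (hB : MeasurableSet B) :
    pastMul 𝕜 hP l (indicatorConstLp 2 hA (measure_ne_top _ A) 1)
        (indicatorConstLp 2 hB (measure_ne_top _ B) 1) =
      indicatorConstLp 2 ((hP n l).measurable (hA.prod hB)) (measure_ne_top _ _) 1 := by
  rw [pastMul_apply, tensor_indicatorConstLp_one]
  exact Lp.indicatorConstLp_compMeasurePreserving _ _ _ (hP n l)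

theorem pastMul_const_one {n : ℕ} (l : Fin n) :
    pastMul 𝕜 hP l (Lp.const 2 (P l) 1) (Lp.const 2 ν 1) = Lp.const 2 (P n) 1 := by
  simp only [← indicatorConstLp_univ, pastMul_indicatorConstLp_one]
  simp

theorem pastMul_pastMul_const_one {n : ℕ} {k l : Fin n} (hkl : k < l) (Y : Lp 𝕜 2 (P k))
    (g : Lp 𝕜 2 ν) :
    pastMul 𝕜 hP l (pastMul 𝕜 hP (⟨k, hkl⟩ : Fin l) Y g) (Lp.const 2 ν 1) =
      pastMul 𝕜 hP k Y g := by
  refine Lp.ext ((coeFn_pastMul hP _ _ _).trans (EventuallyEq.trans ?_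
    (coeFn_pastMul hP _ _ _).symm))
  have hsplit := (hP n l).quasiMeasurePreserving
  filter_upwards [hsplit.ae (Measure.quasiMeasurePreserving_fst.ae
      (coeFn_pastMul hP (⟨k, hkl⟩ : Fin l) Y g)),
    hsplit.ae (Measure.quasiMeasurePreserving_snd.ae (Lp.coeFn_const 2 ν (1 : 𝕜)))] with x h₁ h₂
  simp only [splitAt] at h₁ h₂
  rw [h₁, h₂, Function.const_apply, mul_one]
  rfl

theorem inner_pastMul_of_lt {n : ℕ} {k l : Fin n} (hkl : k < l) (Y : Lp 𝕜 2 (P k))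
    (Y' : Lp 𝕜 2 (P l)) (g : Lp 𝕜 2 ν) {g' : Lp 𝕜 2 ν} (hg' : inner 𝕜 (Lp.const 2 ν 1) g' = 0) :
    inner 𝕜 (pastMul 𝕜 hP k Y g) (pastMul 𝕜 hP l Y' g') = 0 := by
  rw [← pastMul_pastMul_const_one hP hkl, inner_pastMul_pastMul, hg', mul_zero]

variable (b : HilbertBasis ι 𝕜 (Lp 𝕜 2 ν)) {i₀ : ι}

theorem inner_const_one {Ω : Type*} [MeasurableSpace Ω] {μ : Measure Ω} [IsFiniteMeasure μ]
    (f : Lp 𝕜 2 μ) : inner 𝕜 (Lp.const 2 μ 1) f = ∫ x, f x ∂μ := by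
  rw [← indicatorConstLp_univ, L2.inner_indicatorConstLp_one, setIntegral_univ]

theorem inner_const_one_of_ne (hb : b i₀ = Lp.const 2 ν 1) {i : ι} (hi : i ≠ i₀) :
    inner 𝕜 (Lp.const 2 ν 1) (b i) = 0 := by
  rw [← hb]
  exact b.orthonormal.inner_eq_zero hi.symm

/-- The isometry `Y ↦ Y(x₁, …, x_{l-1}) b_i(x_l)`. -/
def chaosIsometry {n : ℕ} (i : ι) (l : Fin n) : Lp 𝕜 2 (P l) →ₗᵢ[𝕜] Lp 𝕜 2 (P n) :=
  pastMulₗᵢ hP l (b.orthonormal.norm_eq_one i)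

theorem orthogonalFamily_chaosIsometry (hb : b i₀ = Lp.const 2 ν 1) (n : ℕ) :
    OrthogonalFamily 𝕜 (fun p : {i // i ≠ i₀} × Fin n => Lp 𝕜 2 (P p.2))
      fun p => chaosIsometry hP b p.1.1 p.2 := by
  rintro ⟨⟨i, hi⟩, k⟩ ⟨⟨j, hj⟩, l⟩ hne Y Z
  simp only [chaosIsometry, pastMulₗᵢ_apply]
  rcases lt_trichotomy k l with hkl | rfl | hlk
  · exact inner_pastMul_of_lt hP hkl _ _ _ (inner_const_one_of_ne b hb hj)
  · have hij : i ≠ j := fun h => hne (by simp [h])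
    rw [inner_pastMul_pastMul, b.orthonormal.inner_eq_zero hij, mul_zero]
  · exact inner_eq_zero_symm.1
      (inner_pastMul_of_lt hP hlk _ _ _ (inner_const_one_of_ne b hb hi))

variable {b} in
theorem inner_pastMul_eq_zero {n : ℕ} {l : Fin n} {f : Lp 𝕜 2 (P n)} {Y : Lp 𝕜 2 (P l)}
    (h : ∀ i, inner 𝕜 f (pastMul 𝕜 hP l Y (b i)) = 0) (g : Lp 𝕜 2 ν) :
    inner 𝕜 f (pastMul 𝕜 hP l Y g) = 0 := by
  have hzero : innerSL 𝕜 f ∘L pastMul 𝕜 hP l Y = 0 :=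
    ContinuousLinearMap.ext_on (Submodule.dense_iff_topologicalClosure_eq_top.2 b.dense_span)
      (by rintro _ ⟨i, rfl⟩; exact h i)
  exact DFunLike.congr_fun hzero g

theorem setIntegral_take_preimage_pi_eq_zero {n : ℕ} (hb : b i₀ = Lp.const 2 ν 1)
    {f : Lp 𝕜 2 (P n)} (h₀ : ∫ x, f x ∂P n = 0)
    (h : ∀ i ≠ i₀, ∀ (l : Fin n) Y, inner 𝕜 f (pastMul 𝕜 hP l Y (b i)) = 0)
    {k : ℕ} (hk : k ≤ n) (s : Fin k → Set α) (hs : ∀ i, MeasurableSet (s i)) :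
    ∫ x in (fun x => Fin.take k hk x) ⁻¹' Set.univ.pi s, f x ∂P n = 0 := by
  induction k with
  | zero => simpa [Set.eq_univ_of_forall] using h₀
  | succ k ih =>
    let l : Fin n := ⟨k, hk⟩
    have hbox : MeasurableSet (Set.univ.pi fun i : Fin k => s i.castSucc) :=
      .univ_pi fun i => hs _
    let Y : Lp 𝕜 2 (P l) := indicatorConstLp 2 hbox (measure_ne_top _ _) 1
    have hY (i : ι) : inner 𝕜 f (pastMul 𝕜 hP l Y (b i)) = 0 := by
      obtain rfl | hi := eq_or_ne i i₀
      · rw [hb, ← indicatorConstLp_univ, pastMul_indicatorConstLp_one, inner_eq_zero_symm,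
          L2.inner_indicatorConstLp_one]
        convert! ih (Nat.le_of_succ_le hk) _ fun i => hs i.castSucc using 3
        ext x
        simp [splitAt, l]
      · exact h i hi l Y
    have hlast := inner_pastMul_eq_zero hP hY
      (indicatorConstLp 2 (hs (Fin.last k)) (measure_ne_top _ _) 1)
    rw [pastMul_indicatorConstLp_one, inner_eq_zero_symm, L2.inner_indicatorConstLp_one] at hlast
    convert! hlast using 3
    ext x
    simp only [Set.mem_preimage, Set.mem_univ_pi, Set.mem_prod, Fin.forall_fin_succ']
    rfl

theorem eq_zero_of_inner_pastMul {n : ℕ} (hb : b i₀ = Lp.const 2 ν 1) {f : Lp 𝕜 2 (P n)}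
    (h₀ : inner 𝕜 (Lp.const 2 (P n) 1) f = 0)
    (h : ∀ i ≠ i₀, ∀ (l : Fin n) Y, inner 𝕜 (pastMul 𝕜 hP l Y (b i)) f = 0) : f = 0 := by
  have hf : Integrable f (P n) := (Lp.memLp f).integrable one_le_two
  rw [Lp.eq_zero_iff_ae_eq_zero]
  refine ae_eq_zero_of_setIntegral_pi_eq_zero hf fun s hs => ?_
  exact setIntegral_take_preimage_pi_eq_zero hP b hb (inner_const_one f ▸ h₀)
    (fun i hi l Y => inner_eq_zero_symm.1 (h i hi l Y)) le_rfl s hs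

theorem hasSum_chaosIsometry (hb : b i₀ = Lp.const 2 ν 1) {n : ℕ} (f : Lp 𝕜 2 (P n)) :
    HasSum (fun p : {i // i ≠ i₀} × Fin n => chaosIsometry hP b p.1.1 p.2
        ((chaosIsometry hP b p.1.1 p.2).toContinuousLinearMap.adjoint f))
      (f - Lp.const 2 (P n) (∫ x, f x ∂P n)) := by
  have he : ‖Lp.const 2 (P n) (1 : 𝕜)‖ = 1 := by simp [Lp.norm_const']
  have hmean : (inner 𝕜 (Lp.const 2 (P n) 1) f : 𝕜) • Lp.const 2 (P n) (1 : 𝕜) =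
      Lp.const 2 (P n) (∫ x, f x ∂P n) := by
    rw [inner_const_one]
    have hsmul := map_smul (Lp.constₗ (E := 𝕜) 2 (P n) 𝕜) (∫ x, f x ∂P n) (1 : 𝕜)
    rw [smul_eq_mul, mul_one] at hsmul
    exact hsmul.symm
  rw [← hmean]
  refine hasSum_adjoint_of_forall_inner_eq_zero (orthogonalFamily_chaosIsometry hP b hb n) he
    (fun p Y => ?_) (fun g hg hV => ?_) f
  · rw [chaosIsometry, pastMulₗᵢ_apply, ← pastMul_const_one hP p.2, inner_pastMul_pastMul,
      inner_const_one_of_ne b hb p.1.2, mul_zero]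
  · exact eq_zero_of_inner_pastMul hP b hb hg fun i hi l Y => hV (⟨i, hi⟩, l) Y

end Chaos

section PolynomialDensity

theorem complexMGF_eq_of_integral_pow_eq {Ω Ω' : Type*} [MeasurableSpace Ω] [MeasurableSpace Ω']
    {P : Measure Ω} {Q : Measure Ω'} {Z : Ω → ℝ} {W : Ω' → ℝ}
    (hP : ∀ t, Integrable (fun x => Real.exp (t * Z x)) P)
    (hQ : ∀ t, Integrable (fun x => Real.exp (t * W x)) Q)
    (h : ∀ n : ℕ, ∫ x, Z x ^ n ∂P = ∫ x, W x ^ n ∂Q) : complexMGF Z P = complexMGF W Q := by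
  have hP' : integrableExpSet Z P = Set.univ := Set.eq_univ_of_forall hP
  have hQ' : integrableExpSet W Q = Set.univ := Set.eq_univ_of_forall hQ
  have hdP : Differentiable ℂ (complexMGF Z P) := fun z =>
    (analyticAt_complexMGF (by simp [hP'])).differentiableAt
  have hdQ : Differentiable ℂ (complexMGF W Q) := fun z =>
    (analyticAt_complexMGF (by simp [hQ'])).differentiableAt
  have hderiv (n : ℕ) :
      iteratedDeriv n (complexMGF Z P) 0 = iteratedDeriv n (complexMGF W Q) 0 := by
    rw [iteratedDeriv_complexMGF (by simp [hP']), iteratedDeriv_complexMGF (by simp [hQ'])]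
    simp only [zero_mul, Complex.exp_zero, mul_one]
    exact_mod_cast congrArg ((↑) : ℝ → ℂ) (h n)
  funext z
  rw [← Complex.taylorSeries_eq_of_entire' 0 z hdP, ← Complex.taylorSeries_eq_of_entire' 0 z hdQ]
  simp_rw [hderiv]

theorem measure_ext_of_integral_pow_eq {P Q : Measure ℝ}
    (hP : ∀ t, Integrable (fun x => Real.exp (t * x)) P)
    (hQ : ∀ t, Integrable (fun x => Real.exp (t * x)) Q)
    (h : ∀ n : ℕ, ∫ x, x ^ n ∂P = ∫ x, x ^ n ∂Q) : P = Q := by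
  have : IsFiniteMeasure P :=
    (integrable_const_iff_isFiniteMeasure one_ne_zero).1 (by simpa using hP 0)
  have : IsFiniteMeasure Q :=
    (integrable_const_iff_isFiniteMeasure one_ne_zero).1 (by simpa using hQ 0)
  exact Measure.ext_of_complexMGF_id_eq (complexMGF_eq_of_integral_pow_eq hP hQ h)

theorem integrable_exp_mul_withDensity_toNNReal {μ : Measure ℝ} {f : ℝ → ℝ}
    (hexp : ∀ t, Integrable (fun x => f x * Real.exp (t * x)) μ) (t : ℝ) :
    Integrable (fun x => Real.exp (t * x)) (μ.withDensity fun x => (f x).toNNReal) := by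
  have hf : AEMeasurable f μ := by simpa using (hexp 0).aemeasurable
  rw [integrable_withDensity_iff_integrable_smul₀ hf.real_toNNReal]
  refine (hexp t).pos_part.congr (ae_of_all _ fun x => ?_)
  simp [NNReal.smul_def, max_mul_of_nonneg, Real.exp_nonneg]

theorem ae_eq_zero_of_integral_mul_pow_eq_zero {μ : Measure ℝ} {f : ℝ → ℝ}
    (hexp : ∀ t, Integrable (fun x => f x * Real.exp (t * x)) μ)
    (h : ∀ n : ℕ, ∫ x, f x * x ^ n ∂μ = 0) : f =ᵐ[μ] 0 := by
  have hf : Integrable f μ := by simpa using hexp 0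
  have hpos := hf.aemeasurable.real_toNNReal
  have hneg := hf.neg.aemeasurable.real_toNNReal
  have hP := integrable_exp_mul_withDensity_toNNReal hexp
  have hQ := integrable_exp_mul_withDensity_toNNReal (μ := μ) (f := -f)
    (fun t => (hexp t).neg.congr (ae_of_all _ fun x => by simp))
  have hPQ : (μ.withDensity fun x => (f x).toNNReal) =
      μ.withDensity fun x => ((-f) x).toNNReal := by
    refine measure_ext_of_integral_pow_eq hP hQ fun n => ?_
    have iP := integrable_pow_of_integrable_exp_mul one_ne_zero (hP 1) (hP (-1)) n
    have iQ := integrable_pow_of_integrable_exp_mul one_ne_zero (hQ 1) (hQ (-1)) n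
    rw [integrable_withDensity_iff_integrable_smul₀ hpos] at iP
    rw [integrable_withDensity_iff_integrable_smul₀ hneg] at iQ
    rw [integral_withDensity_eq_integral_smul₀ hpos, integral_withDensity_eq_integral_smul₀ hneg,
      ← sub_eq_zero, ← integral_sub iP iQ, ← h n]
    refine integral_congr_ae (ae_of_all _ fun x => ?_)
    simp only [NNReal.smul_def, smul_eq_mul, ← sub_mul, Pi.neg_apply,
      Real.coe_toNNReal', max_zero_sub_max_neg_zero_eq_self]
  filter_upwards [(withDensity_eq_iff hpos.coe_nnreal_ennreal hneg.coe_nnreal_ennreal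
    hf.lintegral_lt_top.ne).1 hPQ] with x hx
  have hx' : (f x).toNNReal = (-f x).toNNReal := ENNReal.coe_injective hx
  rw [Pi.zero_apply, ← max_zero_sub_max_neg_zero_eq_self (f x), ← Real.coe_toNNReal',
    ← Real.coe_toNNReal', hx', sub_self]

theorem integrable_eval_gaussianReal (q : ℝ[X]) (μ : ℝ) (v : ℝ≥0) :
    Integrable (fun x => q.eval x) (gaussianReal μ v) := by
  simp_rw [eval_eq_sum_range]
  refine integrable_finsetSum _ fun i _ => Integrable.const_mul ?_ _
  exact integrable_pow_of_mem_interior_integrableExpSet (X := id) (by simp) i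

theorem memLp_eval_gaussianReal (q : ℝ[X]) (μ : ℝ) (v : ℝ≥0) :
    MemLp (fun x => q.eval x) 2 (gaussianReal μ v) := by
  rw [memLp_two_iff_integrable_sq q.continuous.aestronglyMeasurable]
  exact (integrable_eval_gaussianReal (q ^ 2) μ v).congr (ae_of_all _ fun x => eval_pow 2)

theorem integrable_eval_mul_gaussianPDFReal (q : ℝ[X]) (μ : ℝ) {v : ℝ≥0} (hv : v ≠ 0) :
    Integrable (fun x => q.eval x * gaussianPDFReal μ v x) := by
  have h := integrable_eval_gaussianReal q μ v
  rw [gaussianReal_of_var_ne_zero _ hv,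
    integrable_withDensity_iff_integrable_smul' (measurable_gaussianPDF μ v)
      (ae_of_all _ fun _ => gaussianPDF_lt_top)] at h
  simpa [toReal_gaussianPDF, mul_comm] using h

/-- Polynomials as elements of `L²(N(μ, v))`. -/
def polynomialLp (μ : ℝ) (v : ℝ≥0) : ℝ[X] →ₗ[ℝ] Lp ℝ 2 (gaussianReal μ v) where
  toFun q := (memLp_eval_gaussianReal q μ v).toLp
  map_add' p q := by simp only [eval_add]; rfl
  map_smul' c q := by simp only [eval_smul]; rfl

theorem coeFn_polynomialLp (q : ℝ[X]) (μ : ℝ) (v : ℝ≥0) :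
    polynomialLp μ v q =ᵐ[gaussianReal μ v] fun x => q.eval x :=
  (memLp_eval_gaussianReal q μ v).coeFn_toLp

theorem inner_polynomialLp (p q : ℝ[X]) (μ : ℝ) (v : ℝ≥0) :
    inner ℝ (polynomialLp μ v p) (polynomialLp μ v q) =
      ∫ x, (p * q).eval x ∂gaussianReal μ v := by
  rw [L2.inner_def]
  refine integral_congr_ae ?_
  filter_upwards [coeFn_polynomialLp p μ v, coeFn_polynomialLp q μ v] with x hp hq
  simp [hp, hq, mul_comm]

theorem orthogonal_range_polynomialLp (μ : ℝ) (v : ℝ≥0) :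
    (LinearMap.range (polynomialLp μ v))ᗮ = ⊥ := by
  refine (Submodule.eq_bot_iff _).2 fun f hf => (Lp.eq_zero_iff_ae_eq_zero).2 ?_
  refine ae_eq_zero_of_integral_mul_pow_eq_zero (fun t => ?_) fun n => ?_
  · refine (Lp.memLp f).integrable_mul (q := 2) ?_
    rw [memLp_two_iff_integrable_sq (by fun_prop)]
    simpa [← Real.exp_nat_mul, ← mul_assoc] using integrable_exp_mul_gaussianReal (2 * t)
  · rw [← hf _ ⟨X ^ n, rfl⟩, L2.inner_def]
    refine integral_congr_ae ?_
    filter_upwards [coeFn_polynomialLp (X ^ n) μ v] with x hx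
    simp [hx]

end PolynomialDensity

section HermitePolynomials

/-- The probabilists' Hermite polynomial `He_m` with real coefficients. -/
def realHermite (m : ℕ) : ℝ[X] := (hermite m).map (Int.castRingHom ℝ)

theorem realHermite_zero : realHermite 0 = 1 := by simp [realHermite]

theorem realHermite_succ (m : ℕ) :
    realHermite (m + 1) = X * realHermite m - derivative (realHermite m) := by
  simp [realHermite, hermite_succ, derivative_map]

theorem monic_realHermite (m : ℕ) : (realHermite m).Monic := (hermite_monic m).map _

theorem natDegree_realHermite (m : ℕ) : (realHermite m).natDegree = m := by
  rw [realHermite, (hermite_monic m).natDegree_map, natDegree_hermite]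

theorem hermiteH_eq_eval (m : ℕ) (x : ℝ) :
    hermiteH m x = (realHermite m).eval x / √m.factorial := by
  simp_rw [hermiteH, neg_div, iteratedDeriv_eq_iterate, realHermite, eval_map,
    ← algebraMap_int_eq, ← aeval_def, hermite_eq_deriv_gaussian']
  ring

theorem iterate_derivative_realHermite_self (m : ℕ) :
    derivative^[m] (realHermite m) = C (m.factorial : ℝ) := by
  have hdeg : (derivative^[m] (realHermite m)).natDegree = 0 := by
    simpa [natDegree_realHermite] using natDegree_iterate_derivative (realHermite m) m
  have hcoeff : (realHermite m).coeff m = 1 := by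
    simpa [natDegree_realHermite] using (monic_realHermite m).coeff_natDegree
  rw [eq_C_of_natDegree_eq_zero hdeg, coeff_iterate_derivative]
  simp [hcoeff, Nat.descFactorial_self]

theorem hasDerivAt_gaussianPDFReal (v : ℝ≥0) (x : ℝ) :
    HasDerivAt (gaussianPDFReal 0 v) (-(x / v) * gaussianPDFReal 0 v x) x := by
  have hexponent : HasDerivAt (fun x : ℝ => -(x - 0) ^ 2 / (2 * (v : ℝ))) (-(x / v)) x := by
    refine ((((hasDerivAt_id x).sub_const 0).pow 2).neg.div_const _).congr_deriv ?_
    simp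
    field
  rw [gaussianPDFReal_def]
  refine (hexponent.exp.const_mul _).congr_deriv ?_
  ring

theorem hasDerivAt_realHermite_mul_gaussianPDFReal (m : ℕ) (v : ℝ≥0) (x : ℝ) :
    HasDerivAt (fun x => (realHermite m).eval (x / √v) * gaussianPDFReal 0 v x)
      (-(√v)⁻¹ * ((realHermite (m + 1)).eval (x / √v) * gaussianPDFReal 0 v x)) x := by
  have hpoly := ((realHermite m).hasDerivAt (x / √v)).comp x ((hasDerivAt_id x).div_const √v)
  refine (hpoly.mul (hasDerivAt_gaussianPDFReal v x)).congr_deriv ?_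
  have hv : x / v = (√v)⁻¹ * (x / √v) := by
    rw [← div_eq_inv_mul, div_div, Real.mul_self_sqrt v.coe_nonneg]
  simp only [realHermite_succ, eval_sub, eval_mul, eval_X, hv, Function.comp_apply, id]
  ring

theorem integral_mul_realHermite_succ (q : ℝ[X]) (m : ℕ) :
    ∫ x, (q * realHermite (m + 1)).eval x ∂gaussianReal 0 1 =
      ∫ x, (derivative q * realHermite m).eval x ∂gaussianReal 0 1 := by
  have hint (p r : ℝ[X]) :
      Integrable fun x => p.eval x * (r.eval x * gaussianPDFReal 0 1 x) := by
    simpa only [eval_mul, mul_assoc] using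
      integrable_eval_mul_gaussianPDFReal (p * r) 0 one_ne_zero
  have hderiv (x : ℝ) : HasDerivAt (fun x => (realHermite m).eval x * gaussianPDFReal 0 1 x)
      (-((realHermite (m + 1)).eval x * gaussianPDFReal 0 1 x)) x := by
    simpa using hasDerivAt_realHermite_mul_gaussianPDFReal m 1 x
  have hparts := integral_mul_deriv_eq_deriv_mul_of_integrable (fun x _ => q.hasDerivAt x)
    (fun x _ => hderiv x)
    ((hint q (realHermite (m + 1))).neg.congr (ae_of_all _ fun x => neg_mul_eq_mul_neg _ _))
    (hint _ _) (hint _ _)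
  simp only [mul_neg, integral_neg, neg_inj] at hparts
  simp only [integral_gaussianReal_eq_integral_smul one_ne_zero, eval_mul, smul_eq_mul,
    mul_comm (gaussianPDFReal 0 1 _), mul_assoc, hparts]

theorem integral_mul_realHermite (q : ℝ[X]) (m : ℕ) :
    ∫ x, (q * realHermite m).eval x ∂gaussianReal 0 1 =
      ∫ x, (derivative^[m] q).eval x ∂gaussianReal 0 1 := by
  induction m generalizing q with
  | zero => simp [realHermite_zero]
  | succ m ih => rw [integral_mul_realHermite_succ, ih, Function.iterate_succ_apply]

theorem integral_realHermite_mul_self (m : ℕ) :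
    ∫ x, (realHermite m * realHermite m).eval x ∂gaussianReal 0 1 = m.factorial := by
  rw [integral_mul_realHermite, iterate_derivative_realHermite_self]
  simp

theorem integral_realHermite_mul_of_lt {k m : ℕ} (h : k < m) :
    ∫ x, (realHermite k * realHermite m).eval x ∂gaussianReal 0 1 = 0 := by
  rw [integral_mul_realHermite, iterate_derivative_eq_zero (by rwa [natDegree_realHermite])]
  simp

theorem integral_hermiteH_mul (k m : ℕ) :
    ∫ x, hermiteH k x * hermiteH m x ∂gaussianReal 0 1 = if k = m then 1 else 0 := by
  simp_rw [hermiteH_eq_eval, div_mul_div_comm, ← eval_mul, integral_div]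
  obtain h | rfl | h := lt_trichotomy k m
  · rw [integral_realHermite_mul_of_lt h, zero_div, if_neg h.ne]
  · rw [integral_realHermite_mul_self, Real.mul_self_sqrt (by positivity), if_pos rfl]
    exact div_self (by positivity)
  · rw [mul_comm (realHermite k), integral_realHermite_mul_of_lt h, zero_div, if_neg h.ne']

end HermitePolynomials

section HermiteBasis

variable (Δt : ℝ) [hΔt : Fact (0 < Δt)]

/-- The polynomials `H_m(x / √Δt)`. -/
def scaledHermite : Polynomial.Sequence ℝ where
  elems' m := C (√m.factorial)⁻¹ * (realHermite m).comp (C (√Δt)⁻¹ * X)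
  degree_eq' m := by
    have hc : (√Δt)⁻¹ ≠ 0 := inv_ne_zero (Real.sqrt_pos.2 hΔt.out).ne'
    have hm : (√(m.factorial : ℝ))⁻¹ ≠ 0 := by positivity
    have hcomp : (realHermite m).comp (C (√Δt)⁻¹ * X) ≠ 0 := fun h =>
      (monic_realHermite m).ne_zero ((comp_C_mul_X_eq_zero_iff (by simpa using hc)).1 h)
    rw [degree_C_mul hm, degree_eq_natDegree hcomp, natDegree_comp, natDegree_C_mul_X _ hc,
      natDegree_realHermite, mul_one]

theorem eval_scaledHermite (m : ℕ) (x : ℝ) :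
    (scaledHermite Δt m).eval x = hermiteH m (x / √Δt) := by
  change (C (√m.factorial)⁻¹ * (realHermite m).comp (C (√Δt)⁻¹ * X)).eval x = _
  simp [hermiteH_eq_eval, div_eq_inv_mul]

theorem map_div_sqrt_gaussianReal :
    (gaussianReal 0 Δt.toNNReal).map (· / √Δt) = gaussianReal 0 1 := by
  rw [gaussianReal_map_div_const, zero_div]
  congr 1
  ext
  simp [hΔt.out.le, hΔt.out.ne']

theorem orthonormal_scaledHermite :
    Orthonormal ℝ fun m => polynomialLp 0 Δt.toNNReal (scaledHermite Δt m) := by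
  rw [orthonormal_iff_ite]
  intro k m
  rw [inner_polynomialLp, ← integral_hermiteH_mul, ← map_div_sqrt_gaussianReal Δt,
    integral_map (by fun_prop)
      (by simp_rw [hermiteH_eq_eval]; exact Continuous.aestronglyMeasurable (by fun_prop))]
  simp only [eval_mul, eval_scaledHermite]

/-- The normalized Hermite functions `H_m(x / √Δt)` form a Hilbert basis of `L²(N(0, Δt))`. -/
def hermiteBasis : HilbertBasis ℕ ℝ (Lp ℝ 2 (gaussianReal 0 Δt.toNNReal)) :=
  HilbertBasis.mkOfOrthogonalEqBot (orthonormal_scaledHermite Δt) (by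
    have hspan := (scaledHermite Δt).span fun m =>
      (leadingCoeff_ne_zero.2 ((scaledHermite Δt).ne_zero m)).isUnit
    rw [Set.range_comp' (polynomialLp 0 Δt.toNNReal), Submodule.span_image, hspan,
      Submodule.map_top, orthogonal_range_polynomialLp])

theorem hermiteBasis_apply (m : ℕ) :
    hermiteBasis Δt m = polynomialLp 0 Δt.toNNReal (scaledHermite Δt m) := by
  rw [hermiteBasis, HilbertBasis.coe_mkOfOrthogonalEqBot]

theorem coeFn_hermiteBasis (m : ℕ) :
    hermiteBasis Δt m =ᵐ[gaussianReal 0 Δt.toNNReal] fun x => hermiteH m (x / √Δt) := by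
  simpa only [hermiteBasis_apply, eval_scaledHermite] using
    coeFn_polynomialLp (scaledHermite Δt m) 0 Δt.toNNReal

theorem hermiteBasis_zero : hermiteBasis Δt 0 = Lp.const 2 (gaussianReal 0 Δt.toNNReal) 1 := by
  refine Lp.ext ((coeFn_hermiteBasis Δt 0).trans (EventuallyEq.trans ?_ (Lp.coeFn_const ..).symm))
  exact ae_of_all _ fun x => by simp [hermiteH_eq_eval, realHermite_zero]

end HermiteBasis

section Gaussian

variable (n : ℕ) (Δt : ℝ) [hΔt : Fact (0 < Δt)]

theorem density_eq_prod (x : Fin n → ℝ) :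
    density n Δt x = ∏ i, gaussianPDFReal 0 Δt.toNNReal (x i) := by
  have h0 := hΔt.out
  simp only [gaussianPDFReal, Real.coe_toNNReal _ h0.le, Finset.prod_mul_distrib, sub_zero,
    ← Real.exp_sum, Finset.prod_const, Finset.card_univ, Fintype.card_fin, density]
  congr 1
  · rw [Real.sqrt_eq_rpow, ← Real.rpow_neg (by positivity), ← Real.rpow_natCast,
      ← Real.rpow_mul (by positivity)]
    congr 1
    ring
  · rw [← Finset.sum_div, Finset.sum_neg_distrib]

theorem gaussianMeasure_eq_pi :
    gaussianMeasure n Δt = Measure.pi fun _ => gaussianReal 0 Δt.toNNReal := by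
  have h0 : Δt.toNNReal ≠ 0 := by simpa using hΔt.out
  refine (Measure.pi_eq fun s hs => ?_).symm
  rw [gaussianMeasure, withDensity_apply _ (MeasurableSet.univ_pi hs), volume_pi,
    Measure.restrict_pi_pi]
  simp_rw [density_eq_prod]
  rw [← ofReal_integral_eq_lintegral_ofReal
    (Integrable.fintype_prod fun i => (integrable_gaussianPDFReal 0 _).restrict)
    (ae_of_all _ fun x => Finset.prod_nonneg fun i _ => gaussianPDFReal_nonneg _ _ _),
    integral_fintype_prod_eq_prod, ENNReal.ofReal_prod_of_nonneg
    fun i _ => integral_nonneg fun x => gaussianPDFReal_nonneg _ _ _]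
  exact Finset.prod_congr rfl fun i _ => (gaussianReal_apply_eq_integral _ h0 _).symm

instance : IsProbabilityMeasure (gaussianMeasure n Δt) := by
  rw [gaussianMeasure_eq_pi]
  infer_instance

variable {n} in
theorem measurePreserving_splitAt_gaussianMeasure (l : Fin n) :
    MeasurePreserving (splitAt l) (gaussianMeasure n Δt)
      ((gaussianMeasure l Δt).prod (gaussianReal 0 Δt.toNNReal)) := by
  simpa only [gaussianMeasure_eq_pi] using measurePreserving_splitAt l

end Gaussian

section Derivative

variable {n : ℕ} {Δt : ℝ}

theorem firstCoords_add_smul_single (l : Fin n) (x : Fin n → ℝ) (t : ℝ) :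
    firstCoords l.isLt.le (x + t • Pi.single l 1) = firstCoords l.isLt.le x := by
  funext i
  have hi : Fin.castLE l.isLt.le i ≠ l := Fin.ne_of_lt (Fin.lt_def.2 i.isLt)
  simp [firstCoords, hi]

variable [hΔt : Fact (0 < Δt)]

theorem density_add_smul_single (l : Fin n) (x : Fin n → ℝ) (t : ℝ) :
    density n Δt (x + t • Pi.single l 1) = gaussianPDFReal 0 Δt.toNNReal (x l + t) *
      ∏ i ∈ Finset.univ.erase l, gaussianPDFReal 0 Δt.toNNReal (x i) := by
  rw [density_eq_prod, ← Finset.mul_prod_erase _ _ (Finset.mem_univ l)]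
  congr 1
  · simp
  · exact Finset.prod_congr rfl fun i hi => by simp [Finset.ne_of_mem_erase hi]

theorem hasLineDerivAt_realHermite_mul_density (m : ℕ) (l : Fin n) (x : Fin n → ℝ) :
    HasLineDerivAt ℝ (fun y => (realHermite m).eval (y l / √Δt) * density n Δt y)
      (-(√Δt)⁻¹ * ((realHermite (m + 1)).eval (x l / √Δt) * density n Δt x)) x
      (Pi.single l 1) := by
  let C := ∏ i ∈ Finset.univ.erase l, gaussianPDFReal 0 Δt.toNNReal (x i)
  have h := hasDerivAt_realHermite_mul_gaussianPDFReal m Δt.toNNReal (x l + 0)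
  rw [Real.coe_toNNReal _ hΔt.out.le] at h
  refine (((h.comp_const_add (x l) 0).mul_const C).congr_of_eventuallyEq
    (Eventually.of_forall fun t => ?_)).congr_deriv ?_
  · simp [C, density_add_smul_single, mul_assoc]
  · have hx := density_add_smul_single (Δt := Δt) l x 0
    rw [zero_smul, add_zero, add_zero] at hx
    rw [hx, add_zero]
    ring

theorem testDeriv_apply_of_hasLineDerivAt {l : Fin n} {φ : testSpace n Δt} {x : Fin n → ℝ} {d : ℝ}
    (h : HasLineDerivAt ℝ φ.1 d x (Pi.single l 1)) : (testDeriv l φ).1 x = d := by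
  change (∂_{(Pi.single l 1 : Fin n → ℝ)} φ.1) x = d
  rw [lineDerivOp_apply_eq_fderiv, ← (φ.1.differentiableAt).lineDeriv_eq_fderiv, h.lineDeriv]

theorem iterate_testDeriv_mulDensity (l : Fin n) (Z : 𝓢(Fin l → ℝ, ℝ)) (m : ℕ)
    (x : Fin n → ℝ) :
    ((testDeriv l)^[m] (mulDensity (Δt := Δt) l.isLt.le Z)).1 x =
      (-(√Δt)⁻¹) ^ m * Z (firstCoords l.isLt.le x) *
        ((realHermite m).eval (x l / √Δt) * density n Δt x) := by
  induction m generalizing x with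
  | zero => simp [realHermite_zero, mulDensity_apply]
  | succ m ih =>
    rw [Function.iterate_succ_apply']
    refine testDeriv_apply_of_hasLineDerivAt ?_
    refine (((hasLineDerivAt_realHermite_mul_density m l x).const_mul
      ((-(√Δt)⁻¹) ^ m * Z (firstCoords l.isLt.le x))).congr_of_eventuallyEq
      (Eventually.of_forall fun t => ?_)).congr_deriv (by ring)
    rw [ih, firstCoords_add_smul_single]

theorem GenFunctional.pair_iterate_deriv (l : Fin n) (X : GenFunctional n Δt) (m : ℕ)
    (φ : testSpace n Δt) :
    ((deriv l)^[m] X).pair φ = (-1) ^ m * X.pair ((testDeriv l)^[m] φ) := by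
  induction m generalizing X with
  | zero => simp
  | succ m ih =>
    rw [Function.iterate_succ_apply, ih, Function.iterate_succ_apply']
    simp only [deriv, LinearMap.neg_apply, LinearMap.comp_apply]
    ring

end Derivative

section CondExp

variable {n : ℕ} {Δt : ℝ} [hΔt : Fact (0 < Δt)]

theorem integral_gaussianMeasure (g : (Fin n → ℝ) → ℝ) :
    ∫ x, g x ∂gaussianMeasure n Δt = ∫ x, g x * density n Δt x := by
  rw [gaussianMeasure, integral_withDensity_eq_integral_toReal_smul
    (continuous_density n Δt).measurable.ennreal_ofReal (by simp)]
  refine integral_congr_ae (ae_of_all _ fun x => ?_)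
  simp [ENNReal.toReal_ofReal (density_pos n hΔt.out x).le, mul_comm]

theorem GenFunctional.pair_ofL2_eq_inner (X g : Lp ℝ 2 (gaussianMeasure n Δt))
    {φ : testSpace n Δt} (h : ∀ᵐ x ∂gaussianMeasure n Δt, φ.1 x = g x * density n Δt x) :
    (ofL2 X).pair φ = inner ℝ g X := by
  have h' := (ae_withDensity_iff (continuous_density n Δt).measurable.ennreal_ofReal).1 h
  rw [L2.inner_def, integral_gaussianMeasure]
  refine integral_congr_ae ?_
  filter_upwards [h'] with x hx
  rw [hx (by simpa using density_pos n hΔt.out x), Real.inner_apply]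
  ring

theorem GenFunctional.pair_ofL2_mulDensity (Y : Lp ℝ 2 (gaussianMeasure n Δt))
    (Z : 𝓢(Fin n → ℝ, ℝ)) :
    (ofL2 Y).pair (mulDensity le_rfl Z) = inner ℝ (Z.toLp 2 (gaussianMeasure n Δt)) Y := by
  refine pair_ofL2_eq_inner Y _ ?_
  filter_upwards [Z.coeFn_toLp 2 (gaussianMeasure n Δt)] with x hx
  rw [mulDensity_apply, hx]
  rfl

variable (Δt) in
/-- The isometry `Y ↦ Y(ΔW₁, …, ΔW_{l-1}) H_m(ΔW_l / √Δt)`. -/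
def hermiteChaos (m : ℕ) (l : Fin n) :
    Lp ℝ 2 (gaussianMeasure l Δt) →ₗᵢ[ℝ] Lp ℝ 2 (gaussianMeasure n Δt) :=
  chaosIsometry (P := fun n => gaussianMeasure n Δt)
    (fun _ => measurePreserving_splitAt_gaussianMeasure Δt) (hermiteBasis Δt) m l

theorem coeFn_hermiteChaos (m : ℕ) (l : Fin n) (Y : Lp ℝ 2 (gaussianMeasure l Δt)) :
    hermiteChaos Δt m l Y =ᵐ[gaussianMeasure n Δt]
      fun x => Y (firstCoords l.isLt.le x) * hermiteH m (x l / √Δt) := by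
  have hsplit := (measurePreserving_splitAt_gaussianMeasure Δt l).quasiMeasurePreserving
  filter_upwards [coeFn_pastMul (P := fun n => gaussianMeasure n Δt)
      (fun _ => measurePreserving_splitAt_gaussianMeasure Δt) l Y (hermiteBasis Δt m),
    hsplit.ae (Measure.quasiMeasurePreserving_snd.ae (coeFn_hermiteBasis Δt m))] with x hx hH
  exact hx.trans (congrArg _ hH)

/-- The coefficient `Δt^(m/2) / √(m!)` of the expansion. -/
def chaosCoeff (Δt : ℝ) (m : ℕ) : ℝ := Δt ^ ((m : ℝ) / 2) / √m.factorial

variable (Δt) in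
theorem chaosCoeff_ne_zero (m : ℕ) : chaosCoeff Δt m ≠ 0 :=
  (div_pos (Real.rpow_pos_of_pos hΔt.out _) (by positivity)).ne'

variable (Δt) in
theorem inv_chaosCoeff (m : ℕ) : (chaosCoeff Δt m)⁻¹ = (√Δt)⁻¹ ^ m * √m.factorial := by
  rw [chaosCoeff, inv_div, Real.sqrt_eq_rpow Δt, inv_pow, ← Real.rpow_mul_natCast hΔt.out.le,
    div_eq_inv_mul, one_div_mul_eq_div]

theorem iterate_testDeriv_mulDensity_ae_eq (m : ℕ) (l : Fin n) (Z : 𝓢(Fin l → ℝ, ℝ)) :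
    ∀ᵐ x ∂gaussianMeasure n Δt,
      ((testDeriv l)^[m] (mulDensity (Δt := Δt) l.isLt.le Z)).1 x =
        (((-1) ^ m * (chaosCoeff Δt m)⁻¹) •
          hermiteChaos Δt m l (Z.toLp 2 (gaussianMeasure l Δt))) x * density n Δt x := by
  have hfirst := Measure.quasiMeasurePreserving_fst.comp
    (measurePreserving_splitAt_gaussianMeasure Δt l).quasiMeasurePreserving
  filter_upwards [Lp.coeFn_smul ((-1) ^ m * (chaosCoeff Δt m)⁻¹) (hermiteChaos Δt m l _),
    coeFn_hermiteChaos m l (Z.toLp 2 (gaussianMeasure l Δt)),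
    hfirst.ae (Z.coeFn_toLp 2 (gaussianMeasure l Δt))] with x hsmul hchaos hZ
  have hZ' : Z.toLp 2 (gaussianMeasure l Δt) (firstCoords l.isLt.le x) =
    Z (firstCoords l.isLt.le x) := hZ
  rw [iterate_testDeriv_mulDensity, hsmul, Pi.smul_apply, hchaos, hZ', hermiteH_eq_eval,
    inv_chaosCoeff, neg_pow, smul_eq_mul]
  field

/-- The conditional expectation of the `m`-th derivative in the direction `l`: up to the
normalization, the adjoint of `hermiteChaos`. -/
def chaosKernel (X : Lp ℝ 2 (gaussianMeasure n Δt)) (m : ℕ) (l : Fin n) :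
    Lp ℝ 2 (gaussianMeasure l Δt) :=
  (chaosCoeff Δt m)⁻¹ • (hermiteChaos Δt m l).toContinuousLinearMap.adjoint X

theorem isCondExp_chaosKernel (X : Lp ℝ 2 (gaussianMeasure n Δt)) (m : ℕ) (l : Fin n) :
    IsCondExp l.isLt.le ((GenFunctional.deriv l)^[m] (GenFunctional.ofL2 X))
      (GenFunctional.ofL2 (chaosKernel X m l)) := by
  intro Z
  have hsign : (-1 : ℝ) ^ m * (-1) ^ m = 1 := by rw [← mul_pow]; simp
  rw [GenFunctional.pair_iterate_deriv,
    GenFunctional.pair_ofL2_eq_inner X _ (iterate_testDeriv_mulDensity_ae_eq m l Z),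
    GenFunctional.pair_ofL2_mulDensity, chaosKernel, inner_smul_right, real_inner_smul_left,
    ContinuousLinearMap.adjoint_inner_right, ← mul_assoc, ← mul_assoc, hsign, one_mul]
  rfl

end CondExp

section Cutoff

open scoped ContDiff

variable {E F : Type*} [NormedAddCommGroup E] [NormedSpace ℝ E]
  [NormedAddCommGroup F] [NormedSpace ℝ F]

theorem seminorm_le_of_forall_eq_smul {g : E → ℝ} (hg : ContDiff ℝ ∞ g) {b : ℕ → ℝ}
    (hb₀ : ∀ i, 0 ≤ b i) (hb : ∀ i x, ‖iteratedFDeriv ℝ i g x‖ ≤ b i * ‖x‖) {f h : 𝓢(E, F)}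
    (hh : ∀ x, h x = g x • f x) (k m : ℕ) :
    SchwartzMap.seminorm ℝ k m h ≤
      ∑ i ∈ Finset.range (m + 1),
        m.choose i * (b i * SchwartzMap.seminorm ℝ (k + 1) (m - i) f) := by
  have hC (i : ℕ) : 0 ≤ b i * SchwartzMap.seminorm ℝ (k + 1) (m - i) f :=
    mul_nonneg (hb₀ i) (apply_nonneg _ _)
  refine SchwartzMap.seminorm_le_bound ℝ k m _
    (Finset.sum_nonneg fun i _ => mul_nonneg (Nat.cast_nonneg _) (hC i)) fun x => ?_
  rw [show (h : E → F) = fun y => g y • f y from funext hh]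
  calc ‖x‖ ^ k * ‖iteratedFDeriv ℝ m (fun y => g y • f y) x‖
      ≤ ‖x‖ ^ k * ∑ i ∈ Finset.range (m + 1),
          m.choose i * ‖iteratedFDeriv ℝ i g x‖ * ‖iteratedFDeriv ℝ (m - i) f x‖ := by
        gcongr
        exact norm_iteratedFDeriv_smul_le hg (f.smooth ⊤) x (mod_cast le_top)
    _ ≤ ‖x‖ ^ k * ∑ i ∈ Finset.range (m + 1),
          m.choose i * (b i * ‖x‖) * ‖iteratedFDeriv ℝ (m - i) f x‖ := by
        gcongr with i
        exact hb i x
    _ = ∑ i ∈ Finset.range (m + 1),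
          m.choose i * (b i * (‖x‖ ^ (k + 1) * ‖iteratedFDeriv ℝ (m - i) f x‖)) := by
        rw [Finset.mul_sum]
        exact Finset.sum_congr rfl fun i _ => by ring
    _ ≤ _ := by
        gcongr with i
        · exact hb₀ i
        · exact SchwartzMap.le_seminorm ℝ _ _ f x

variable [FiniteDimensional ℝ E]

variable (E) in
/-- A smooth cutoff function, equal to `1` on the unit ball. -/
def cutoff : ContDiffBump (0 : E) := ⟨1, 2, one_pos, one_lt_two⟩

theorem exists_norm_iteratedFDeriv_cutoff_sub_one_le (i : ℕ) :
    ∃ B, 0 ≤ B ∧ ∀ x, ‖iteratedFDeriv ℝ i (fun y => cutoff E y - 1) x‖ ≤ B * ‖x‖ := by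
  obtain ⟨C, hC⟩ := ((cutoff E).hasCompactSupport.toSchwartzMap (cutoff E).contDiff).decay' 0 i
  simp only [pow_zero, one_mul] at hC
  have hC₀ : 0 ≤ C := (norm_nonneg _).trans (hC 0)
  refine ⟨C + 1, by positivity, fun x => ?_⟩
  obtain hx | hx := lt_or_ge ‖x‖ 1
  · have hzero : (fun y => cutoff E y - 1) =ᶠ[𝓝 x] 0 := by
      filter_upwards [Metric.isOpen_ball.mem_nhds (mem_ball_zero_iff.2 hx)] with y hy
      rw [(cutoff E).one_of_mem_closedBall (Metric.ball_subset_closedBall hy), sub_self,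
        Pi.zero_apply]
    rw [(hzero.iteratedFDeriv ℝ i).eq_of_nhds, iteratedFDeriv_zero, Pi.zero_apply, norm_zero]
    positivity
  · have hone : ‖iteratedFDeriv ℝ i (fun _ : E => (1 : ℝ)) x‖ ≤ 1 := by
      obtain rfl | hi := eq_or_ne i 0
      · simp
      · simp [iteratedFDeriv_const_of_ne hi]
    calc ‖iteratedFDeriv ℝ i (fun y => cutoff E y - 1) x‖
        ≤ ‖iteratedFDeriv ℝ i (cutoff E) x‖ + ‖iteratedFDeriv ℝ i (fun _ => (1 : ℝ)) x‖ := by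
          rw [fun_iteratedFDeriv_sub_apply (cutoff E).contDiffAt contDiffAt_const]
          exact norm_sub_le _ _
      _ ≤ C + 1 := add_le_add (hC x) hone
      _ ≤ (C + 1) * ‖x‖ := le_mul_of_one_le_right (by positivity) hx

theorem norm_iteratedFDeriv_cutoff_smul_sub_one_le {i : ℕ} {B : ℝ}
    (hB : ∀ x, ‖iteratedFDeriv ℝ i (fun y => cutoff E y - 1) x‖ ≤ B * ‖x‖) {r : ℝ} (hr₀ : 0 ≤ r)
    (hr₁ : r ≤ 1) (x : E) :
    ‖iteratedFDeriv ℝ i (fun y => cutoff E (r • y) - 1) x‖ ≤ r * B * ‖x‖ := by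
  have hsmooth : ContDiff ℝ i fun y => cutoff E y - 1 := (cutoff E).contDiff.sub contDiff_const
  rw [iteratedFDeriv_comp_const_smul r hsmooth, norm_smul, norm_pow, Real.norm_of_nonneg hr₀]
  calc r ^ i * ‖iteratedFDeriv ℝ i (fun y => cutoff E y - 1) (r • x)‖
      ≤ 1 * (B * ‖r • x‖) :=
        mul_le_mul (pow_le_one₀ hr₀ hr₁) (hB _) (norm_nonneg _) zero_le_one
    _ = r * B * ‖x‖ := by
        rw [norm_smul, Real.norm_of_nonneg hr₀]
        ring

theorem hasTemperateGrowth_cutoff_smul (r : ℝ) :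
    (fun x => cutoff E (r • x)).HasTemperateGrowth :=
  ((cutoff E).hasCompactSupport.hasTemperateGrowth (cutoff E).contDiff).comp
    (r • ContinuousLinearMap.id ℝ E).hasTemperateGrowth

theorem exists_seminorm_smulLeftCLM_cutoff_sub_le (f : 𝓢(E, F)) (k m : ℕ) :
    ∃ C, ∀ r, 0 ≤ r → r ≤ 1 →
      SchwartzMap.seminorm ℝ k m (smulLeftCLM F (fun x => cutoff E (r • x)) f - f) ≤ r * C := by
  choose B hB₀ hB using fun i => exists_norm_iteratedFDeriv_cutoff_sub_one_le (E := E) i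
  refine ⟨∑ i ∈ Finset.range (m + 1),
    m.choose i * (B i * SchwartzMap.seminorm ℝ (k + 1) (m - i) f), fun r hr₀ hr₁ => ?_⟩
  refine (seminorm_le_of_forall_eq_smul (f := f)
    ((hasTemperateGrowth_cutoff_smul r).1.sub contDiff_const)
    (fun i => mul_nonneg hr₀ (hB₀ i))
    (fun i => norm_iteratedFDeriv_cutoff_smul_sub_one_le (hB i) hr₀ hr₁)
    (fun x => ?_) k m).trans_eq ?_
  · rw [sub_apply, smulLeftCLM_apply_apply (hasTemperateGrowth_cutoff_smul r), sub_smul, one_smul]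
  · rw [Finset.mul_sum]
    exact Finset.sum_congr rfl fun i _ => by ring

theorem tendsto_smulLeftCLM_cutoff (f : 𝓢(E, F)) :
    Tendsto (fun r : ℝ => smulLeftCLM F (fun x => cutoff E (r • x)) f) (𝓝[>] 0) (𝓝 f) := by
  rw [(schwartz_withSeminorms ℝ E F).tendsto_nhds]
  rintro ⟨k, m⟩ ε hε
  obtain ⟨C, hC⟩ := exists_seminorm_smulLeftCLM_cutoff_sub_le f k m
  have hlim : Tendsto (fun r : ℝ => r * C) (𝓝[>] 0) (𝓝 0) :=
    ((continuous_mul_const C).tendsto' 0 0 (zero_mul C)).mono_left nhdsWithin_le_nhds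
  filter_upwards [hlim.eventually_lt_const hε, Ioo_mem_nhdsGT one_pos] with r hr hr'
  exact (hC r hr'.1.le hr'.2.le).trans_lt hr

variable (E F) in
theorem dense_setOf_hasCompactSupport : Dense {f : 𝓢(E, F) | HasCompactSupport f} := by
  refine fun f => mem_closure_of_tendsto (tendsto_smulLeftCLM_cutoff f) ?_
  filter_upwards [self_mem_nhdsWithin] with r hr
  rw [smulLeftCLM_apply (hasTemperateGrowth_cutoff_smul r)]
  exact ((cutoff E).hasCompactSupport.comp_smul (ne_of_gt hr)).smul_right

end Cutoff

section Uniqueness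

variable {n : ℕ} {Δt : ℝ} [hΔt : Fact (0 < Δt)]

theorem exists_mulDensity_eq_sqrt_density_mul {f : 𝓢(Fin n → ℝ, ℝ)} (hf : HasCompactSupport f) :
    ∃ Z : 𝓢(Fin n → ℝ, ℝ), ∀ x,
      (mulDensity (Δt := Δt) le_rfl Z).1 x = √(density n Δt x) * f x := by
  have hpos (x : Fin n → ℝ) : sqrtDensity n Δt x ≠ 0 := by
    rw [sqrtDensity_apply]
    exact (Real.sqrt_pos.2 (density_pos n hΔt.out x)).ne'
  refine ⟨(hf.mul_right (f' := fun x => (sqrtDensity n Δt x)⁻¹)).toSchwartzMap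
    ((f.smooth ⊤).mul (((sqrtDensity n Δt).smooth ⊤).inv hpos)), fun x => ?_⟩
  rw [mulDensity_apply, ← sqrtDensity_apply, ← sqrtDensity_mul_self]
  change f x * (sqrtDensity n Δt x)⁻¹ * _ = _
  field [hpos x]

theorem GenFunctional.ext_mulDensity {V W : GenFunctional n Δt}
    (h : ∀ Z : 𝓢(Fin n → ℝ, ℝ), V.pair (mulDensity le_rfl Z) = W.pair (mulDensity le_rfl Z)) :
    V = W := by
  obtain ⟨U, hU⟩ := V.continuous_pair
  obtain ⟨U', hU'⟩ := W.continuous_pair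
  have hcompact : Set.EqOn U U' {f | HasCompactSupport f} := fun f hf => by
    obtain ⟨Z, hZ⟩ := exists_mulDensity_eq_sqrt_density_mul (Δt := Δt) hf
    rw [← hU _ f hZ, ← hU' _ f hZ, h]
  have hUU' := U.continuous.ext_on (dense_setOf_hasCompactSupport _ _) U'.continuous hcompact
  ext φ
  obtain ⟨f, hf⟩ := φ.2
  rw [hU φ f hf, hU' φ f hf, hUU']

theorem isCondExp_iff_eq_chaosKernel (X : Lp ℝ 2 (gaussianMeasure n Δt)) (m : ℕ) (l : Fin n)
    (V : GenFunctional l Δt) :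
    IsCondExp l.isLt.le ((GenFunctional.deriv l)^[m] (GenFunctional.ofL2 X)) V ↔
      V = GenFunctional.ofL2 (chaosKernel X m l) := by
  refine ⟨fun hV => GenFunctional.ext_mulDensity fun Z => ?_, ?_⟩
  · rw [← hV Z, isCondExp_chaosKernel X m l Z]
  · rintro rfl
    exact isCondExp_chaosKernel X m l

end Uniqueness

section Expansion

theorem hasSum_sum_succ {ι M : Type*} [Fintype ι] [AddCommMonoid M] [TopologicalSpace M]
    [ContinuousAdd M] [RegularSpace M] {f : ℕ → ι → M} {a : M}
    (h : HasSum (fun p : {m // m ≠ 0} × ι => f p.1 p.2) a) :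
    HasSum (fun m => ∑ i, f (m + 1) i) a := by
  let e : ℕ ≃ {m // m ≠ 0} :=
    ⟨fun m => ⟨m + 1, m.succ_ne_zero⟩, fun m => m.1 - 1, fun m => by simp,
      fun m => Subtype.ext (Nat.succ_pred_eq_of_ne_zero m.2)⟩
  exact e.hasSum_iff.2 (h.prod_fiberwise fun m => hasSum_fintype _)

variable {n : ℕ} {Δt : ℝ} [hΔt : Fact (0 < Δt)]

theorem coeFn_smul_hermiteChaos (m : ℕ) (l : Fin n) (Y : Lp ℝ 2 (gaussianMeasure l Δt)) :
    ⇑(chaosCoeff Δt m • hermiteChaos Δt m l Y) =ᵐ[gaussianMeasure n Δt] summand Δt m l Y := by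
  filter_upwards [Lp.coeFn_smul (chaosCoeff Δt m) (hermiteChaos Δt m l Y),
    coeFn_hermiteChaos m l Y] with x hsmul hchaos
  rw [hsmul, Pi.smul_apply, hchaos, smul_eq_mul, ← mul_assoc]
  rfl

theorem memLp_summand (m : ℕ) (l : Fin n) (Y : Lp ℝ 2 (gaussianMeasure l Δt)) :
    MemLp (summand Δt m l Y) 2 (gaussianMeasure n Δt) :=
  (Lp.memLp _).ae_eq (coeFn_smul_hermiteChaos m l Y)

theorem toLp_summand (m : ℕ) (l : Fin n) (Y : Lp ℝ 2 (gaussianMeasure l Δt)) :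
    (memLp_summand m l Y).toLp = chaosCoeff Δt m • hermiteChaos Δt m l Y :=
  Lp.ext ((MemLp.coeFn_toLp _).trans (coeFn_smul_hermiteChaos m l Y).symm)

theorem toLp_summand_chaosKernel (X : Lp ℝ 2 (gaussianMeasure n Δt)) (m : ℕ) (l : Fin n) :
    (memLp_summand m l (chaosKernel X m l)).toLp =
      hermiteChaos Δt m l ((hermiteChaos Δt m l).toContinuousLinearMap.adjoint X) := by
  rw [toLp_summand, chaosKernel, map_smul, smul_inv_smul₀ (chaosCoeff_ne_zero Δt m)]

theorem hasSum_hermiteChaos (X : Lp ℝ 2 (gaussianMeasure n Δt)) :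
    HasSum (fun m : ℕ => ∑ l : Fin n, hermiteChaos Δt (m + 1) l
        ((hermiteChaos Δt (m + 1) l).toContinuousLinearMap.adjoint X))
      (X - Lp.const 2 (gaussianMeasure n Δt) (∫ x, X x ∂gaussianMeasure n Δt)) :=
  hasSum_sum_succ
    (f := fun m l => hermiteChaos Δt m l ((hermiteChaos Δt m l).toContinuousLinearMap.adjoint X))
    (hasSum_chaosIsometry (P := fun n => gaussianMeasure n Δt)
      (fun _ => measurePreserving_splitAt_gaussianMeasure Δt) (hermiteBasis Δt)
      (hermiteBasis_zero Δt) X)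

end Expansion

end DiscreteWiener

end

theorem theorem2p1 (N : ℕ) (Δt : ℝ) [Fact (0 < Δt)] (X : Lp ℝ 2 (gaussianMeasure N Δt)) :
    ∃ Y : (m : ℕ) → (l : Fin N) → Lp ℝ 2 (gaussianMeasure l Δt),
      (∀ m ≥ 1, ∀ (l : Fin N) (V : GenFunctional l Δt),
        IsCondExp l.isLt.le ((GenFunctional.deriv l)^[m] (GenFunctional.ofL2 X)) V ↔
          V = GenFunctional.ofL2 (Y m l)) ∧
      ∃ (hX : MemLp (fun x => X x - ∫ y, X y ∂gaussianMeasure N Δt) 2 (gaussianMeasure N Δt))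
        (hterm : ∀ m l, MemLp (summand Δt m l (Y m l)) 2 (gaussianMeasure N Δt)),
        HasSum (fun m : ℕ => ∑ l : Fin N, (hterm (m + 1) l).toLp) hX.toLp := by
  have hX : MemLp (fun x => X x - ∫ y, X y ∂gaussianMeasure N Δt) 2 (gaussianMeasure N Δt) :=
    (Lp.memLp X).sub (memLp_const _)
  have hcentered : hX.toLp =
      X - Lp.const 2 (gaussianMeasure N Δt) (∫ y, X y ∂gaussianMeasure N Δt) := by
    simpa only [Lp.toLp_coeFn] using! MemLp.toLp_sub (Lp.memLp X) (memLp_const _)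
  refine ⟨chaosKernel X, fun m _ l V => isCondExp_iff_eq_chaosKernel X m l V, hX,
    fun m l => memLp_summand m l (chaosKernel X m l), ?_⟩
  simp only [toLp_summand_chaosKernel, hcentered]
  exact hasSum_hermiteChaos X
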